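/- Let $1<p<\infty$ and let $X=(X,d,\mu)$ be a complete metric space with a Borel measure $\mu$ such that $0<\mu(B)<\infty$ for all balls $B$, $\mu$ is doubling, and $X$ satisfies the $p$-Poincaré inequality: there are $C\ge 0$, $\lambda\ge 1$ such that $\frac1{\mu(B)}\int_B|h-h_B|\,d\mu\le C\operatorname{diam}(B)\big(\frac1{\mu(\lambda B)}\int_{\lambda B}g^p\,d\mu\big)^{1/p}$, where $h_B=\frac1{\mu(B)}\int_B h\,d\mu$, for all balls $B$, all $h:X\to\mathbb R$ integrable on balls and all upper gradients $g$ of $h$. Let $\Omega\subset X$ be a bounded domain (nonempty, open, connected) with $\mu(\partial\Omega)=0$. Curves and modulus. For $S=\Omega$ or $S=\overline\Omega$ (with the restricted metric and measure), let $\mathrm{Curv}(S)$ be the set of rectifiable arc-length parametrized curves $\gamma:[0,\ell_\gamma]\to S$, constant curves ($\ell_\gamma=0$) included, and for Borel $\rho\ge0$ let $\int_\gamma\rho\,ds=\int_0^{\ell_\gamma}\rho(\gamma(t))\,dt$. For $\Gamma\subset\mathrm{Curv}(S)$ and $b:\Gamma\to[0,\infty]$ put $$\mathrm{Mod}_p(\Gamma,b)=\inf\Big\{\int_{S}\rho^p\,d\mu:\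 \rho:S\to[0,\infty]\text{ Borel},\ \int_\gamma\rho\,ds\ge b(\gamma)\ \text{for all }\gamma\in\Gamma\Big\},\qquad \mathrm{Mod}_p(\Gamma)=\mathrm{Mod}_p(\Gamma,1).$$ "For $p$-a.e. curve" means: except for a family of curves with $\mathrm{Mod}_p=0$. A weak minimizer of $\mathrm{Mod}_p(\Gamma,b)$ is a Borel function $\rho:S\to[0,\infty]$ with $\int_\gamma\rho\,ds\ge b(\gamma)$ for $p$-a.e. $\gamma\in\Gamma$ and $\int_S\rho^p\,d\mu=\mathrm{Mod}_p(\Gamma,b)$. Newtonian functions. A Borel function $g:S\to[0,\infty]$ is an upper gradient (a $p$-weak upper gradient) of $v:S\to[-\infty,\infty]$ if $|v(\gamma(0))-v(\gamma(\ell_\gamma))|\le\int_\gamma g\,ds$ for every ($p$-a.e.) nonconstant $\gamma\in\mathrm{Curv}(S)$, where $|\infty-\infty|=|(-\infty)-(-\infty)|=\infty$; upper gradients on $X$ are defined in the same way. $N^{1,p}(S)$ is the set of $\mu$-measurable $v:S\to[-\infty,\infty]$ in $L^p(S)$ that have an upper gradient in $L^p(S)$, and $g_v$ denotes the minimal $p$-weak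 upper gradient, i.e. the ($\mu$-a.e. unique) $p$-weak upper gradient in $L^p(S)$ with $g_v\le g$ $\mu$-a.e. for every $p$-weak upper gradient $g\in L^p(S)$ of $v$. Further, $N^{1,p}_0(\Omega)=\{F|_\Omega: F\in N^{1,p}(\overline\Omega),\ F=0\text{ on }\partial\Omega\}$. Let $f\in N^{1,p}(\overline\Omega)$ be a Borel function, and let $u$ be a solution of the $p$-Dirichlet problem with boundary data $f$, that is, $u-f|_\Omega\in N^{1,p}_0(\Omega)$ and $$\int_\Omega g_u^p\,d\mu=\inf\Big\{\int_\Omega g_v^p\,d\mu:\ v-f|_\Omega\in N^{1,p}_0(\Omega)\Big\},$$ where $g_u,g_v$ are the minimal $p$-weak upper gradients in $\Omega$. Let $\Gamma=\{\gamma\in\mathrm{Curv}(\overline\Omega):\gamma(0),\gamma(\ell_\gamma)\in\partial\Omega\}$, and let $b:\Gamma\to[0,\infty]$, $b(\gamma)=|f(\gamma(0))-f(\gamma(\ell_\gamma))|$, where $b(\gamma)=0$ if $\gamma$ is constant. Then $\mathrm{Mod}_p(\Gamma,b)$ (with $S=\overline\Omega$) has a weak minimizer $\rho^*$, which lies in $L^p(\overline\Omega)$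 and is unique up to $\mu$-a.e. equality in $\overline\Omega$, and $$g_u=\rho^*\quad\mu\text{-a.e. in }\Omega,\qquad \int_\Omega g_u^p\,d\mu=\mathrm{Mod}_p(\Gamma,b)<\infty .$$ -/

import Mathlib

open MeasureTheory Set
open scoped ENNReal NNReal

/-!  Convention for subsets.  The metric measure spaces that occur are a space `X` and subsets `S` of
it (a bounded domain `Ω` and its closure) with the restricted metric and measure.  A Borel function
on a Borel subset `S` is represented by a Borel function on `X`; every definition below that takes
a set `S` uses only the values of the functions on `S`. -/

namespace MetricDirichlet

noncomputable section

variable {X : Type*} [MetricSpace X]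

/-- A rectifiable curve `[0, length] → X` parametrized by arc length; the length may be `0`
(constant curves).  The values of `toFun` outside `[0, length]` are irrelevant.  Continuity is
automatic, see `RectCurve.edist_le`. -/
structure RectCurve (X : Type*) [MetricSpace X] where
  toFun : ℝ → X
  length : ℝ
  length_nonneg : 0 ≤ length
  arcLength : ∀ t ∈ Icc 0 length, eVariationOn toFun (Icc 0 t) = ENNReal.ofReal t

/-- The initial point `γ(0)`. -/
def RectCurve.source (γ : RectCurve X) : X := γ.toFun 0

/-- The end point `γ(ℓ_γ)`. -/
def RectCurve.target (γ : RectCurve X) : X := γ.toFun γ.length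

/-- The family of all curves (constant ones included) whose image lies in `S`. -/
def curvesIn (S : Set X) : Set (RectCurve X) :=
  {γ | ∀ t ∈ Icc 0 γ.length, γ.toFun t ∈ S}

/-- Curves parametrized by arc length are `1`-Lipschitz on `[0, length]`. -/
theorem RectCurve.edist_le (γ : RectCurve X) {s t : ℝ} (hs : 0 ≤ s) (hst : s ≤ t)
    (ht : t ≤ γ.length) : edist (γ.toFun s) (γ.toFun t) ≤ ENNReal.ofReal (t - s) := by
  have h1 : eVariationOn γ.toFun (Icc 0 s) + eVariationOn γ.toFun (Icc s t)
      = eVariationOn γ.toFun (Icc 0 t) := by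
    have h := eVariationOn.Icc_add_Icc γ.toFun (s := univ) hs hst (mem_univ s)
    simpa using h
  rw [γ.arcLength s ⟨hs, hst.trans ht⟩, γ.arcLength t ⟨hs.trans hst, ht⟩] at h1
  have h2 : edist (γ.toFun s) (γ.toFun t) ≤ eVariationOn γ.toFun (Icc s t) :=
    eVariationOn.edist_le _ (left_mem_Icc.2 hst) (right_mem_Icc.2 hst)
  refine h2.trans ?_
  rw [ENNReal.ofReal_sub _ hs]
  exact ENNReal.le_sub_of_add_le_left ENNReal.ofReal_ne_top h1.le

/-- The curve integral `∫_γ ρ ds` of a nonnegative function. -/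
def lineIntegral (ρ : X → ℝ≥0∞) (γ : RectCurve X) : ℝ≥0∞ :=
  ∫⁻ t in Icc 0 γ.length, ρ (γ.toFun t)

/-- The variation `|f(γ(0)) - f(γ(ℓ_γ))|` of an extended real-valued function between the end points
of `γ`, with the convention `|∞ - ∞| = |(-∞) - (-∞)| = ∞` (this is what the subtraction of
`EReal` gives) if `γ` is nonconstant.  On a constant curve the variation is `0`. -/
def endpointVariation (f : X → EReal) (γ : RectCurve X) : ℝ≥0∞ :=
  open Classical in if γ.length = 0 then 0 else (f γ.source - f γ.target).abs

variable [MeasurableSpace X]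

/-- Admissible densities for the curve family `Γ` with respect to the bounding function `b`. -/
def IsAdmissible (Γ : Set (RectCurve X)) (b : RectCurve X → ℝ≥0∞) (ρ : X → ℝ≥0∞) : Prop :=
  Measurable ρ ∧ ∀ γ ∈ Γ, b γ ≤ lineIntegral ρ γ

/-- The generalized modulus `Mod_p(Γ, b)` in the metric measure space `(S, μ|_S)`. -/
def genModulus (p : ℝ) (μ : Measure X) (S : Set X) (Γ : Set (RectCurve X))
    (b : RectCurve X → ℝ≥0∞) : ℝ≥0∞ :=
  ⨅ (ρ : X → ℝ≥0∞) (_ : IsAdmissible Γ b ρ), ∫⁻ x in S, ρ x ^ p ∂μ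

/-- The classical `p`-modulus of a curve family in `(S, μ|_S)`. -/
def pModulus (p : ℝ) (μ : Measure X) (S : Set X) (Γ : Set (RectCurve X)) : ℝ≥0∞ :=
  genModulus p μ S Γ (fun _ => 1)

/-- The property `P` holds for `p`-almost every curve of the family `Γ`, in `(S, μ|_S)`. -/
def AECurve (p : ℝ) (μ : Measure X) (S : Set X) (Γ : Set (RectCurve X))
    (P : RectCurve X → Prop) : Prop :=
  pModulus p μ S {γ ∈ Γ | ¬ P γ} = 0

/-- Weakly admissible densities: the admissibility inequality holds for `p`-a.e. curve of `Γ`. -/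
def IsWeaklyAdmissible (p : ℝ) (μ : Measure X) (S : Set X) (Γ : Set (RectCurve X))
    (b : RectCurve X → ℝ≥0∞) (ρ : X → ℝ≥0∞) : Prop :=
  Measurable ρ ∧ AECurve p μ S Γ (fun γ => b γ ≤ lineIntegral ρ γ)

/-- Weak minimizers of the generalized modulus problem. -/
def IsWeakMinimizer (p : ℝ) (μ : Measure X) (S : Set X) (Γ : Set (RectCurve X))
    (b : RectCurve X → ℝ≥0∞) (ρ : X → ℝ≥0∞) : Prop :=
  IsWeaklyAdmissible p μ S Γ b ρ ∧ ∫⁻ x in S, ρ x ^ p ∂μ = genModulus p μ S Γ b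

/-- `g` is an upper gradient of `f` in `S`. -/
def IsUpperGradient (S : Set X) (f : X → EReal) (g : X → ℝ≥0∞) : Prop :=
  Measurable g ∧ ∀ γ ∈ curvesIn S, 0 < γ.length →
    (f γ.source - f γ.target).abs ≤ lineIntegral g γ

/-- `g` is a `p`-weak upper gradient of `f` in `S`: the upper gradient inequality holds for `p`-a.e.
nonconstant curve in `S`. -/
def IsWeakUpperGradient (p : ℝ) (μ : Measure X) (S : Set X) (f : X → EReal)
    (g : X → ℝ≥0∞) : Prop :=
  Measurable g ∧ AECurve p μ S {γ ∈ curvesIn S | 0 < γ.length}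
    (fun γ => (f γ.source - f γ.target).abs ≤ lineIntegral g γ)

/-- `g` is (a Borel representative of) the minimal `p`-weak upper gradient of `f` in `S`: a
`p`-weak upper gradient in `L^p(S)` that is a.e. smallest among all those in `L^p(S)`. -/
def IsMinimalWeakUpperGradient (p : ℝ) (μ : Measure X) (S : Set X) (f : X → EReal)
    (g : X → ℝ≥0∞) : Prop :=
  IsWeakUpperGradient p μ S f g ∧ ∫⁻ x in S, g x ^ p ∂μ < ∞ ∧
    ∀ g' : X → ℝ≥0∞, IsWeakUpperGradient p μ S f g' → ∫⁻ x in S, g' x ^ p ∂μ < ∞ →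
      g ≤ᵐ[μ.restrict S] g'

/-- The Newtonian space `N^{1,p}(S)`: functions in `L^p(S)` (measurable with respect to the
completion of `μ`) with an upper gradient in `L^p(S)`. -/
def MemNewtonian (p : ℝ) (μ : Measure X) (S : Set X) (f : X → EReal) : Prop :=
  AEMeasurable f (μ.restrict S) ∧ ∫⁻ x in S, (f x).abs ^ p ∂μ < ∞ ∧
    ∃ g : X → ℝ≥0∞, IsUpperGradient S f g ∧ ∫⁻ x in S, g x ^ p ∂μ < ∞

/-- The Newtonian space `N^{1,p}_0(Ω)` with zero boundary values: restrictions to `Ω` of functions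
in `N^{1,p}(closure Ω)` that vanish on the boundary of `Ω`. -/
def MemNewtonianZero (p : ℝ) (μ : Measure X) (Ω : Set X) (h : X → EReal) : Prop :=
  ∃ F : X → EReal, MemNewtonian p μ (closure Ω) F ∧ (∀ x ∈ frontier Ω, F x = 0) ∧
    ∀ x ∈ Ω, F x = h x

/-- Competitors in the `p`-Dirichlet problem with boundary data `f`: `v - f ∈ N^{1,p}_0(Ω)`. -/
def IsCompetitor (p : ℝ) (μ : Measure X) (Ω : Set X) (f v : X → EReal) : Prop :=
  MemNewtonianZero p μ Ω (fun x => v x - f x)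

/-- The infimum of `∫_Ω g_v ^ p dμ` over all `v` with `v - f ∈ N^{1,p}_0(Ω)`. -/
def dirichletInf (p : ℝ) (μ : Measure X) (Ω : Set X) (f : X → EReal) : ℝ≥0∞ :=
  ⨅ (v : X → EReal) (_ : IsCompetitor p μ Ω f v) (g : X → ℝ≥0∞)
    (_ : IsMinimalWeakUpperGradient p μ Ω v g), ∫⁻ x in Ω, g x ^ p ∂μ

/-- `u` solves the `p`-Dirichlet problem in `Ω` with boundary data `f`. -/
def IsDirichletSolution (p : ℝ) (μ : Measure X) (Ω : Set X) (f u : X → EReal) : Prop :=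
  IsCompetitor p μ Ω f u ∧ ∀ g : X → ℝ≥0∞, IsMinimalWeakUpperGradient p μ Ω u g →
    ∫⁻ x in Ω, g x ^ p ∂μ = dirichletInf p μ Ω f

/-- The family of boundary-to-boundary curves in the closure of `Ω`. -/
def boundaryCurves (Ω : Set X) : Set (RectCurve X) :=
  {γ ∈ curvesIn (closure Ω) | γ.source ∈ frontier Ω ∧ γ.target ∈ frontier Ω}

/-- All balls have positive finite measure and the measure is doubling. -/
def IsDoubling (μ : Measure X) : Prop :=
  (∀ (x : X) (r : ℝ), 0 < r → 0 < μ (Metric.ball x r) ∧ μ (Metric.ball x r) < ∞) ∧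
    ∃ C : ℝ≥0, ∀ (x : X) (r : ℝ), 0 < r →
      μ (Metric.ball x (2 * r)) ≤ C * μ (Metric.ball x r)

/-- The `p`-Poincaré inequality for functions that are integrable on balls and their upper
gradients. -/
def IsPoincare (p : ℝ) (μ : Measure X) : Prop :=
  ∃ (C : ℝ≥0) (lam : ℝ), 1 ≤ lam ∧ ∀ f : X → ℝ,
    (∀ (x : X) (r : ℝ), IntegrableOn f (Metric.ball x r) μ) →
    ∀ g : X → ℝ≥0∞, IsUpperGradient univ (fun x => (f x : EReal)) g →
    ∀ (x : X) (r : ℝ), 0 < r →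
      ⨍⁻ y in Metric.ball x r, ‖f y - ⨍ z in Metric.ball x r, f z ∂μ‖ₑ ∂μ ≤
        C * ENNReal.ofReal (Metric.diam (Metric.ball x r)) *
          (⨍⁻ y in Metric.ball x (lam * r), g y ^ p ∂μ) ^ (1 / p)

end

end MetricDirichlet

open MetricDirichlet

/-! The two extremal problems have the same value because a competitor of either one can be turned
into a competitor of the other.

From functions to densities. Let `g` be a weak upper gradient in `Ω` of a Dirichlet competitor. Its
difference from `f` extends to a Newtonian function `F` vanishing on the boundary. Along almost
every boundary-to-boundary curve, `F + f` is absolutely continuous, has the end values of `f`, and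
has derivative bounded by `g` at the times spent in `Ω` and by a fixed `L^p` density at all times.
Hence `g`, glued with that density outside `Ω`, is weakly admissible, and since the boundary is null
its energy is that of `g` (`exists_isWeaklyAdmissible`). Weak admissibility is enough to bound the
modulus (`genModulus_le_of_isWeaklyAdmissible`).

From densities to functions. For an admissible `ρ` of finite energy, consider the least cost of
reaching `x` from the boundary, paying `f` at the starting point and the integral of `ρ` on the way
(`reachCost`). Admissibility says that boundary-to-boundary curves are never shortcuts, so this cost
equals `f` on the boundary; concatenation of curves shows that `ρ` controls its increments. As `f`
may be unbounded and signed, it is first truncated at level `k` and shifted to be nonnegative, and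
the remainder of `f` is added back afterwards. The remainder contributes an upper gradient of `f`
cut off to `|f| ≥ k`, whose effect on the energy disappears as `k → ∞`
(`dirichletInf_le_genModulus`). The cost is measurable because its strict sublevel sets are
projections of Borel sets of curves, hence analytic, hence measurable for the completed measure.

The glued density built from `g_u` therefore attains the modulus, and strict convexity of the `p`-th
power makes it unique. -/

namespace MetricDirichlet

open Filter Topology

/-! ### Absolutely continuous functions on an interval -/

section

/-- A function whose increments are bounded by the integral of an integrable function `G` is
absolutely continuous, and its derivative is bounded by `G` almost everywhere. -/
theorem absolutelyContinuous_and_deriv_le {h : ℝ → ℝ} {G : ℝ → ℝ≥0∞} {a b : ℝ} (hab : a ≤ b)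
    (hGm : AEMeasurable G (volume.restrict (Icc a b))) (hG : ∫⁻ x in Icc a b, G x ≠ ∞)
    (hh : ∀ s t, a ≤ s → s ≤ t → t ≤ b → ENNReal.ofReal |h s - h t| ≤ ∫⁻ x in Icc s t, G x) :
    AbsolutelyContinuousOnInterval h a b ∧
      ∀ᵐ x, x ∈ Ioo a b → ENNReal.ofReal |deriv h x| ≤ G x := by
  let g : ℝ → ℝ := fun x => (G x).toReal
  have hg : IntegrableOn g (Icc a b) := integrable_toReal_of_lintegral_ne_top hGm hG
  have hgi : IntervalIntegrable g volume a b := by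
    rwa [intervalIntegrable_iff_integrableOn_Icc_of_le hab]
  -- The increments of `h` are dominated by those of the indefinite integral `Φ` of `G`, so `h`
  -- inherits absolute continuity from `Φ`, and difference quotients compare where both derivatives
  -- exist.
  let Φ : ℝ → ℝ := fun x => ∫ t in a..x, g t
  have hΦ : AbsolutelyContinuousOnInterval Φ a b :=
    hgi.absolutelyContinuousOnInterval_intervalIntegral left_mem_uIcc
  have key : ∀ s t, a ≤ s → s ≤ t → t ≤ b → |h s - h t| ≤ Φ t - Φ s := by
    intro s t has hst htb
    have hsub : Icc s t ⊆ Icc a b := Icc_subset_Icc has htb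
    have h1 : Φ t - Φ s = ∫ x in s..t, g x := by
      apply intervalIntegral.integral_interval_sub_left
      · exact hgi.mono_set (by rw [uIcc_of_le hab, uIcc_of_le (has.trans hst)];
                               exact Icc_subset_Icc_right htb)
      · exact hgi.mono_set (by rw [uIcc_of_le hab, uIcc_of_le has];
                               exact Icc_subset_Icc_right (hst.trans htb))
    have hfin : ∫⁻ x in Icc s t, G x ≠ ∞ := ne_top_of_le_ne_top hG (lintegral_mono_set hsub)
    have hm : AEMeasurable G (volume.restrict (Icc s t)) := hGm.mono_set hsub
    rw [h1, intervalIntegral.integral_of_le hst, ← integral_Icc_eq_integral_Ioc,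
      integral_toReal hm (ae_lt_top' hm hfin)]
    exact (ENNReal.ofReal_le_iff_le_toReal hfin).1 (hh s t has hst htb)
  have key' : ∀ s ∈ Icc a b, ∀ t ∈ Icc a b, |h s - h t| ≤ |Φ s - Φ t| := by
    intro s hs t ht
    rcases le_total s t with hst | hst
    · rw [abs_sub_comm (Φ s)]
      exact (key s t hs.1 hst ht.2).trans (le_abs_self _)
    · rw [abs_sub_comm (h s)]
      exact (key t s ht.1 hst hs.2).trans (le_abs_self _)
  have hac : AbsolutelyContinuousOnInterval h a b := by
    refine squeeze_zero' (Eventually.of_forall fun E => Finset.sum_nonneg fun _ _ => dist_nonneg)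
      ?_ hΦ
    filter_upwards [mem_inf_of_right (mem_principal_self _)] with E hE
    refine Finset.sum_le_sum fun i hi => ?_
    have := hE.1 i hi
    rw [uIcc_of_le hab] at this
    exact key' _ this.1 _ this.2
  refine ⟨hac, ?_⟩
  filter_upwards [hac.ae_differentiableAt, hgi.ae_hasDerivAt_integral] with x hx1 hx2 hx
  have hxu : x ∈ uIcc a b := by rw [uIcc_of_le hab]; exact Ioo_subset_Icc_self hx
  have hd := (hx1 hxu).hasDerivAt
  have hΦd : HasDerivAt Φ (g x) x := hx2 hxu a left_mem_uIcc
  have hle : |deriv h x| ≤ |g x| := by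
    refine le_of_tendsto_of_tendsto hd.tendsto_slope.abs hΦd.tendsto_slope.abs ?_
    have hnb : ∀ᶠ y in 𝓝[≠] x, y ∈ Icc a b :=
      mem_nhdsWithin_of_mem_nhds (Icc_mem_nhds hx.1 hx.2)
    filter_upwards [hnb] with y hy
    simp only [slope_def_field, abs_div]
    exact div_le_div_of_nonneg_right (key' y hy x (Ioo_subset_Icc_self hx)) (abs_nonneg _)
  rw [abs_of_nonneg ENNReal.toReal_nonneg] at hle
  exact (ENNReal.ofReal_le_ofReal hle).trans ENNReal.ofReal_toReal_le

/-- Increments of an absolutely continuous function are bounded by the integral of any bound of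
its derivative. -/
theorem ofReal_abs_sub_le_lintegral {h : ℝ → ℝ} {H : ℝ → ℝ≥0∞} {a b : ℝ} (hab : a ≤ b)
    (hac : AbsolutelyContinuousOnInterval h a b)
    (hH : ∀ᵐ x, x ∈ Ioo a b → ENNReal.ofReal |deriv h x| ≤ H x) :
    ENNReal.ofReal |h a - h b| ≤ ∫⁻ x in Icc a b, H x := by
  rw [abs_sub_comm, ← hac.integral_deriv_eq_sub, ← Real.norm_eq_abs, ofReal_norm,
    intervalIntegral.integral_of_le hab, integral_Ioc_eq_integral_Ioo]
  refine (enorm_integral_le_lintegral_enorm _).trans ?_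
  refine le_trans ?_ (lintegral_mono_set Ioo_subset_Icc_self)
  refine lintegral_mono_ae ((ae_restrict_iff' measurableSet_Ioo).2 ?_)
  filter_upwards [hH] with x hx hx'
  rw [← ofReal_norm, Real.norm_eq_abs]
  exact hx hx'

/-- If the increments of `h` are bounded by the integrals of two functions, they are bounded by
the integral of the minimum. -/
theorem ofReal_abs_sub_le_lintegral_min {h : ℝ → ℝ} {G G' : ℝ → ℝ≥0∞} {a b : ℝ} (hab : a ≤ b)
    (hGm : AEMeasurable G (volume.restrict (Icc a b))) (hG : ∫⁻ x in Icc a b, G x ≠ ∞)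
    (hh : ∀ s t, a ≤ s → s ≤ t → t ≤ b → ENNReal.ofReal |h s - h t| ≤ ∫⁻ x in Icc s t, G x)
    (hGm' : AEMeasurable G' (volume.restrict (Icc a b))) (hG' : ∫⁻ x in Icc a b, G' x ≠ ∞)
    (hh' : ∀ s t, a ≤ s → s ≤ t → t ≤ b → ENNReal.ofReal |h s - h t| ≤ ∫⁻ x in Icc s t, G' x) :
    ENNReal.ofReal |h a - h b| ≤ ∫⁻ x in Icc a b, min (G x) (G' x) := by
  obtain ⟨hac, h1⟩ := absolutelyContinuous_and_deriv_le hab hGm hG hh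
  obtain ⟨-, h2⟩ := absolutelyContinuous_and_deriv_le hab hGm' hG' hh'
  refine ofReal_abs_sub_le_lintegral hab hac ?_
  filter_upwards [h1, h2] with x hx1 hx2 hx
  exact le_min (hx1 hx) (hx2 hx)

/-- Gluing: if the increments of `h` are bounded by the integral of `G`, and on the subintervals of
the open set `U` by the integral of `g`, then they are bounded by the integral of the function
which is `g` on `U` and `G` elsewhere. -/
theorem ofReal_abs_sub_le_lintegral_piecewise {h : ℝ → ℝ} {G g : ℝ → ℝ≥0∞} {a b : ℝ} (hab : a ≤ b)
    {U V : Set ℝ} (hV : IsOpen V) (hUV : U ∩ Ioo a b = V ∩ Ioo a b)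
    (hGm : AEMeasurable G (volume.restrict (Icc a b))) (hG : ∫⁻ x in Icc a b, G x ≠ ∞)
    (hh : ∀ s t, a ≤ s → s ≤ t → t ≤ b → ENNReal.ofReal |h s - h t| ≤ ∫⁻ x in Icc s t, G x)
    (hgm : AEMeasurable g (volume.restrict (Icc a b))) (hg : ∫⁻ x in Icc a b, g x ≠ ∞)
    (hhg : ∀ s t, a ≤ s → s ≤ t → t ≤ b → Icc s t ⊆ U →
      ENNReal.ofReal |h s - h t| ≤ ∫⁻ x in Icc s t, g x) [∀ x, Decidable (x ∈ U)] :
    ENNReal.ofReal |h a - h b| ≤ ∫⁻ x in Icc a b, U.piecewise g G x := by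
  obtain ⟨hac, h1⟩ := absolutelyContinuous_and_deriv_le hab hGm hG hh
  refine ofReal_abs_sub_le_lintegral hab hac ?_
  -- Rational intervals suffice to reach every point of the open set, and there are only countably
  -- many, so the exceptional null sets can be united.
  have h2 : ∀ q : ℚ × ℚ, ∀ᵐ x : ℝ, Icc (q.1 : ℝ) q.2 ⊆ U ∩ Ioo a b → x ∈ Ioo (q.1 : ℝ) q.2 →
      ENNReal.ofReal |deriv h x| ≤ g x := by
    intro q
    by_cases hq : Icc (q.1 : ℝ) q.2 ⊆ U ∩ Ioo a b
    swap
    · exact Eventually.of_forall fun x hx => absurd hx hq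
    rcases lt_or_ge (q.2 : ℝ) q.1 with hlt | hle
    · refine Eventually.of_forall fun x _ hx => ?_
      exact absurd (hx.1.trans hx.2) hlt.not_gt
    have ha : a < q.1 := (hq (left_mem_Icc.2 hle)).2.1
    have hb : q.2 < b := (hq (right_mem_Icc.2 hle)).2.2
    have hsub : Icc (q.1 : ℝ) q.2 ⊆ Icc a b := Icc_subset_Icc ha.le hb.le
    filter_upwards [(absolutelyContinuous_and_deriv_le hle (hgm.mono_set hsub)
      (ne_top_of_le_ne_top hg (lintegral_mono_set hsub)) fun s t hs hst ht =>
        hhg s t (ha.le.trans hs) hst (ht.trans hb.le)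
          ((Icc_subset_Icc hs ht).trans (hq.trans inter_subset_left))).2] with x hx _ hxq
    exact hx hxq
  filter_upwards [h1, ae_all_iff.2 h2] with x hx1 hx2 hx
  by_cases hxU : x ∈ U
  · rw [piecewise_eq_of_mem _ _ _ hxU]
    have hxV : x ∈ V ∩ Ioo a b := hUV ▸ ⟨hxU, hx⟩
    obtain ⟨l, r, hlr, hsub⟩ := mem_nhds_iff_exists_Ioo_subset.1
      ((hV.inter isOpen_Ioo).mem_nhds hxV)
    obtain ⟨q1, hq1, hq1'⟩ := exists_rat_btwn hlr.1
    obtain ⟨q2, hq2, hq2'⟩ := exists_rat_btwn hlr.2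
    refine hx2 (q1, q2) ?_ ⟨hq1', hq2⟩
    rw [hUV]
    exact (Icc_subset_Ioo hq1 hq2').trans hsub
  · rw [piecewise_eq_of_notMem _ _ _ hxU]
    exact hx1 hx

end

/-! ### Subcurves, reversal, concatenation and their line integrals -/

section

variable {X : Type*} [MetricSpace X]

namespace RectCurve

theorem eVariationOn_Icc (γ : RectCurve X) {s t : ℝ} (hs : 0 ≤ s) (hst : s ≤ t)
    (ht : t ≤ γ.length) : eVariationOn γ.toFun (Icc s t) = ENNReal.ofReal (t - s) := by
  have h1 : eVariationOn γ.toFun (Icc 0 s) + eVariationOn γ.toFun (Icc s t)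
      = eVariationOn γ.toFun (Icc 0 t) := by
    simpa using eVariationOn.Icc_add_Icc γ.toFun (s := univ) hs hst (mem_univ s)
  rw [γ.arcLength s ⟨hs, hst.trans ht⟩, γ.arcLength t ⟨hs.trans hst, ht⟩] at h1
  rw [ENNReal.ofReal_sub _ hs, ← h1, ENNReal.add_sub_cancel_left ENNReal.ofReal_ne_top]

theorem continuousOn (γ : RectCurve X) : ContinuousOn γ.toFun (Icc 0 γ.length) := by
  have : LipschitzOnWith 1 γ.toFun (Icc 0 γ.length) := by
    intro s hs t ht
    rw [ENNReal.coe_one, one_mul]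
    rcases le_total s t with h | h
    · rw [edist_dist s t, Real.dist_eq, abs_sub_comm, abs_of_nonneg (sub_nonneg.2 h)]
      exact γ.edist_le hs.1 h ht.2
    · rw [edist_comm, edist_dist s t, Real.dist_eq, abs_of_nonneg (sub_nonneg.2 h)]
      exact γ.edist_le ht.1 h hs.2
  exact this.continuousOn

/-- The restriction of a curve to a subinterval. -/
def sub (γ : RectCurve X) (s t : ℝ) (hs : 0 ≤ s) (hst : s ≤ t) (ht : t ≤ γ.length) :
    RectCurve X where
  toFun r := γ.toFun (r + s)
  length := t - s
  length_nonneg := sub_nonneg.2 hst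
  arcLength r hr := by
    have h := eVariationOn.comp_eq_of_monotoneOn γ.toFun (t := Icc 0 r) (fun x => x + s)
      (fun x _ y _ hxy => by simpa using hxy)
    rw [image_add_const_Icc, zero_add] at h
    have h2 := γ.eVariationOn_Icc hs (t := r + s) (by linarith [hr.1]) (by linarith [hr.2])
    rw [add_sub_cancel_right] at h2
    exact h.trans h2

/-- The curve traversed backwards. -/
def reverse (γ : RectCurve X) : RectCurve X where
  toFun r := γ.toFun (γ.length - r)
  length := γ.length
  length_nonneg := γ.length_nonneg
  arcLength r hr := by
    have h := eVariationOn.comp_eq_of_antitoneOn γ.toFun (t := Icc 0 r) (fun x => γ.length - x)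
      (fun x _ y _ hxy => sub_le_sub_left hxy _)
    rw [image_const_sub_Icc, sub_zero] at h
    have h2 := γ.eVariationOn_Icc (s := γ.length - r) (t := γ.length) (by linarith [hr.2])
      (by linarith [hr.1]) le_rfl
    rw [sub_sub_cancel] at h2
    exact h.trans h2

open Classical in
/-- The concatenation of two curves. -/
noncomputable def concat (γ δ : RectCurve X) (h : γ.target = δ.source) : RectCurve X where
  toFun r := if r ≤ γ.length then γ.toFun r else δ.toFun (r - γ.length)
  length := γ.length + δ.length
  length_nonneg := add_nonneg γ.length_nonneg δ.length_nonneg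
  arcLength t ht := by
    rcases le_total t γ.length with htl | htl
    · rw [← γ.arcLength t ⟨ht.1, htl⟩]
      exact eVariationOn.congr fun r hr => if_pos (hr.2.trans htl)
    · have h1 := eVariationOn.Icc_add_Icc
        (fun r => if r ≤ γ.length then γ.toFun r else δ.toFun (r - γ.length)) (s := univ)
        γ.length_nonneg htl (mem_univ _)
      simp only [univ_inter] at h1
      rw [← h1]
      have h2 : eVariationOn (fun r => if r ≤ γ.length then γ.toFun r else
          δ.toFun (r - γ.length)) (Icc 0 γ.length) = ENNReal.ofReal γ.length := by
        rw [← γ.arcLength γ.length ⟨γ.length_nonneg, le_rfl⟩]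
        exact eVariationOn.congr fun r hr => if_pos hr.2
      have h3 : eVariationOn (fun r => if r ≤ γ.length then γ.toFun r else
          δ.toFun (r - γ.length)) (Icc γ.length t) = ENNReal.ofReal (t - γ.length) := by
        have hc := eVariationOn.comp_eq_of_monotoneOn δ.toFun (t := Icc γ.length t)
          (fun x => x - γ.length) (fun x _ y _ hxy => by simpa using hxy)
        rw [image_sub_const_Icc, sub_self,
          δ.arcLength _ ⟨sub_nonneg.2 htl, by linarith [ht.2]⟩] at hc
        rw [← hc]
        refine eVariationOn.congr fun r hr => ?_
        -- At the junction the value is taken from the first curve; there the hypothesis on the end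
        -- points makes it agree with the second.
        rcases hr.1.eq_or_lt with rfl | hlt
        · simpa [target, source] using h
        · exact if_neg hlt.not_ge
      rw [h2, h3, ← ENNReal.ofReal_add γ.length_nonneg (sub_nonneg.2 htl)]
      congr 1
      ring

/-- The constant curve. -/
def const (x : X) : RectCurve X where
  toFun _ := x
  length := 0
  length_nonneg := le_rfl
  arcLength t ht := by
    have : t = 0 := le_antisymm ht.2 ht.1
    subst this
    simp

theorem source_sub (γ : RectCurve X) (s t : ℝ) (hs : 0 ≤ s) (hst : s ≤ t) (ht : t ≤ γ.length) :
    (γ.sub s t hs hst ht).source = γ.toFun s := by simp [sub, source]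

theorem target_sub (γ : RectCurve X) (s t : ℝ) (hs : 0 ≤ s) (hst : s ≤ t) (ht : t ≤ γ.length) :
    (γ.sub s t hs hst ht).target = γ.toFun t := by simp [sub, target]

theorem source_reverse (γ : RectCurve X) : γ.reverse.source = γ.target := by
  simp [reverse, source, target]

theorem target_reverse (γ : RectCurve X) : γ.reverse.target = γ.source := by
  simp [reverse, source, target]

theorem source_concat (γ δ : RectCurve X) (h : γ.target = δ.source) :
    (γ.concat δ h).source = γ.source := by
  simp [concat, source, γ.length_nonneg]

theorem target_concat (γ δ : RectCurve X) (h : γ.target = δ.source) :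
    (γ.concat δ h).target = δ.target := by
  rcases δ.length_nonneg.eq_or_lt with h0 | h0
  · simp only [target, source] at h
    simp [concat, target, ← h0, h]
  · simp [concat, target, h0]

theorem target_eq_source_of_length_eq_zero (γ : RectCurve X) (h : γ.length = 0) :
    γ.target = γ.source := by
  rw [target, source, h]

end RectCurve

open RectCurve

theorem sub_mem_curvesIn {S : Set X} {γ : RectCurve X} {s t : ℝ} (hs : 0 ≤ s)
    (hst : s ≤ t) (ht : t ≤ γ.length) (h : ∀ r ∈ Icc s t, γ.toFun r ∈ S) :
    γ.sub s t hs hst ht ∈ curvesIn S := by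
  intro r hr
  exact h _ ⟨by linarith [hr.1], by have := hr.2; simp only [sub] at this; linarith⟩

theorem reverse_mem_curvesIn {S : Set X} {γ : RectCurve X} (hγ : γ ∈ curvesIn S) :
    γ.reverse ∈ curvesIn S := fun _ hr =>
  hγ _ ⟨sub_nonneg.2 hr.2, sub_le_self _ hr.1⟩

theorem concat_mem_curvesIn {S : Set X} {γ δ : RectCurve X} (h : γ.target = δ.source)
    (hγ : γ ∈ curvesIn S) (hδ : δ ∈ curvesIn S) : γ.concat δ h ∈ curvesIn S := by
  intro r hr
  simp only [concat] at hr ⊢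
  split_ifs with hle
  · exact hγ r ⟨hr.1, hle⟩
  · exact hδ _ ⟨by linarith, by linarith [hr.2]⟩

theorem lineIntegral_sub (ρ : X → ℝ≥0∞) (γ : RectCurve X) {s t : ℝ} (hs : 0 ≤ s) (hst : s ≤ t)
    (ht : t ≤ γ.length) :
    lineIntegral ρ (γ.sub s t hs hst ht) = ∫⁻ r in Icc s t, ρ (γ.toFun r) := by
  have h := (measurePreserving_add_right (volume : Measure ℝ) s).setLIntegral_comp_preimage_emb
    (measurableEmbedding_addRight s) (fun r => ρ (γ.toFun r)) (Icc s t)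
  rw [preimage_add_const_Icc, sub_self] at h
  exact h

theorem lineIntegral_reverse (ρ : X → ℝ≥0∞) (γ : RectCurve X) :
    lineIntegral ρ γ.reverse = lineIntegral ρ γ := by
  have h := (Measure.measurePreserving_sub_left (volume : Measure ℝ)
    γ.length).setLIntegral_comp_preimage_emb
    (Homeomorph.subLeft γ.length).measurableEmbedding (fun r => ρ (γ.toFun r)) (Icc 0 γ.length)
  rw [preimage_const_sub_Icc, sub_self, sub_zero] at h
  exact h

theorem lineIntegral_concat (ρ : X → ℝ≥0∞) (γ δ : RectCurve X) (h : γ.target = δ.source) :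
    lineIntegral ρ (γ.concat δ h) = lineIntegral ρ γ + lineIntegral ρ δ := by
  have hU : Icc 0 (γ.length + δ.length)
      = Icc 0 γ.length ∪ Ioc γ.length (γ.length + δ.length) :=
    (Icc_union_Ioc_eq_Icc γ.length_nonneg (by linarith [δ.length_nonneg])).symm
  have hd : Disjoint (Icc 0 γ.length) (Ioc γ.length (γ.length + δ.length)) :=
    disjoint_left.2 fun x hx hx' => hx'.1.not_ge hx.2
  rw [lineIntegral, show (γ.concat δ h).length = γ.length + δ.length from rfl, hU,
    lintegral_union measurableSet_Ioc hd]
  congr 1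
  · exact setLIntegral_congr_fun measurableSet_Icc fun r hr => by
      simp [concat, hr.2]
  · have h2 := (measurePreserving_add_right (volume : Measure ℝ)
      (-γ.length)).setLIntegral_comp_preimage_emb
      (measurableEmbedding_addRight (-γ.length)) (fun r => ρ (δ.toFun r)) (Ioc 0 δ.length)
    rw [preimage_add_const_Ioc, zero_sub, sub_neg_eq_add, neg_neg, add_comm δ.length] at h2
    rw [lineIntegral, ← setLIntegral_congr Ioc_ae_eq_Icc, ← h2]
    exact setLIntegral_congr_fun measurableSet_Ioc fun r hr => by
      simp [concat, hr.1.not_ge, sub_eq_add_neg]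

theorem lineIntegral_const (ρ : X → ℝ≥0∞) (x : X) : lineIntegral ρ (const x) = 0 := by
  simp [lineIntegral, RectCurve.const]

variable [MeasurableSpace X] [BorelSpace X]

theorem RectCurve.aemeasurable_comp (γ : RectCurve X) {ρ : X → ℝ≥0∞} (hρ : Measurable ρ) :
    AEMeasurable (fun r => ρ (γ.toFun r)) (volume.restrict (Icc 0 γ.length)) :=
  hρ.comp_aemeasurable (γ.continuousOn.aemeasurable measurableSet_Icc)

theorem lineIntegral_add {ρ : X → ℝ≥0∞} (hρ : Measurable ρ) (η : X → ℝ≥0∞) (γ : RectCurve X) :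
    lineIntegral (fun x => ρ x + η x) γ = lineIntegral ρ γ + lineIntegral η γ :=
  lintegral_add_left' (γ.aemeasurable_comp hρ) _

theorem lineIntegral_const_mul (c : ℝ≥0∞) {ρ : X → ℝ≥0∞} (hρ : Measurable ρ) (γ : RectCurve X) :
    lineIntegral (fun x => c * ρ x) γ = c * lineIntegral ρ γ :=
  lintegral_const_mul'' c (γ.aemeasurable_comp hρ)

end

/-! ### Properties of almost every curve and weak upper gradients -/

section

variable {X : Type*} [MetricSpace X] [MeasurableSpace X] [BorelSpace X]
  {p : ℝ} {μ : Measure X} {S : Set X} {Γ : Set (RectCurve X)}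

omit [MetricSpace X] [BorelSpace X] in
theorem lintegral_add_rpow_lt_top (hp : 1 ≤ p) {ν : Measure X} {g η : X → ℝ≥0∞}
    (hgm : Measurable g) (hg : ∫⁻ x, g x ^ p ∂ν < ∞) (hη : ∫⁻ x, η x ^ p ∂ν < ∞) :
    ∫⁻ x, (g x + η x) ^ p ∂ν < ∞ := by
  have hle : ∫⁻ x, (g x + η x) ^ p ∂ν ≤
      ∫⁻ x, 2 ^ (p - 1) * (g x ^ p + η x ^ p) ∂ν :=
    lintegral_mono fun x => ENNReal.rpow_add_le_mul_rpow_add_rpow _ _ hp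
  refine hle.trans_lt ?_
  have h2 : (2 : ℝ≥0∞) ^ (p - 1) ≠ ∞ :=
    ENNReal.rpow_ne_top_of_nonneg (by linarith) ENNReal.ofNat_ne_top
  rw [lintegral_const_mul' _ _ h2, lintegral_add_left (hgm.pow_const p)]
  exact ENNReal.mul_lt_top h2.lt_top (ENNReal.add_lt_top.2 ⟨hg, hη⟩)

omit [MetricSpace X] [BorelSpace X] in
theorem lintegral_const_mul_rpow (hp : 0 ≤ p) (ν : Measure X) (c : ℝ≥0∞) {g : X → ℝ≥0∞}
    (hgm : Measurable g) : ∫⁻ x, (c * g x) ^ p ∂ν = c ^ p * ∫⁻ x, g x ^ p ∂ν := by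
  rw [← lintegral_const_mul _ (hgm.pow_const p)]
  simp_rw [ENNReal.mul_rpow_of_nonneg _ _ hp]

omit [MetricSpace X] [BorelSpace X] in
/-- A sequence of densities with summable energies is dominated by one density of finite energy. -/
theorem exists_dominating (hp : 0 < p) (ν : Measure X) {θ : ℕ → X → ℝ≥0∞}
    (hm : ∀ n, Measurable (θ n)) (hsum : ∑' n, ∫⁻ x, θ n x ^ p ∂ν < ∞) :
    ∃ η : X → ℝ≥0∞, Measurable η ∧ ∫⁻ x, η x ^ p ∂ν < ∞ ∧ ∀ n x, θ n x ≤ η x := by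
  refine ⟨fun x => (∑' n, θ n x ^ p) ^ (1 / p), ?_, ?_, ?_⟩
  · exact (Measurable.tsum fun n => (hm n).pow_const p).pow_const _
  · simp_rw [← ENNReal.rpow_mul, one_div, inv_mul_cancel₀ hp.ne', ENNReal.rpow_one]
    rwa [lintegral_tsum fun n => ((hm n).pow_const p).aemeasurable]
  · intro n x
    rw [one_div, ENNReal.le_rpow_inv_iff hp]
    exact ENNReal.le_tsum n

/-- A property holds for `p`-almost every curve if and only if there is a density of finite energy
such that it holds for all curves along which the density has a finite integral. -/
theorem aeCurve_iff (hp : 0 < p) {P : RectCurve X → Prop} :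
    AECurve p μ S Γ P ↔ ∃ η : X → ℝ≥0∞, Measurable η ∧ ∫⁻ x in S, η x ^ p ∂μ < ∞ ∧
      ∀ γ ∈ Γ, lineIntegral η γ ≠ ∞ → P γ := by
  constructor
  · intro h
    obtain ⟨ε, hε, hεs⟩ := ENNReal.exists_pos_sum_of_countable (ε := 1) one_ne_zero ℕ
    have hc : ∀ n : ℕ, ((n : ℝ≥0∞) + 1) ^ p ≠ 0 ∧ ((n : ℝ≥0∞) + 1) ^ p ≠ ∞ := by
      intro n
      have h1 : (n : ℝ≥0∞) + 1 ≠ ∞ := by simp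
      exact ⟨(ENNReal.rpow_pos (by simp) h1).ne', ENNReal.rpow_ne_top_of_nonneg hp.le h1⟩
    -- The energies are chosen so small that the multiples `(n + 1) ρ n` still have summable
    -- energies. On an exceptional curve such a multiple integrates to at least `n + 1`, so a
    -- density dominating all of them has infinite integral there.
    have : ∀ n : ℕ, ∃ ρ : X → ℝ≥0∞, IsAdmissible {γ ∈ Γ | ¬ P γ} (fun _ => 1) ρ ∧
        ∫⁻ x in S, ρ x ^ p ∂μ < ε n / ((n : ℝ≥0∞) + 1) ^ p := by
      intro n
      have hpos : pModulus p μ S {γ ∈ Γ | ¬ P γ} < ε n / ((n : ℝ≥0∞) + 1) ^ p := by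
        rw [h]
        exact ENNReal.div_pos (ENNReal.coe_pos.2 (hε n)).ne' (hc n).2
      obtain ⟨ρ, hρ⟩ := iInf_lt_iff.1 hpos
      obtain ⟨hρ1, hρ2⟩ := iInf_lt_iff.1 hρ
      exact ⟨ρ, hρ1, hρ2⟩
    choose ρ hρ hρε using this
    obtain ⟨η, hηm, hηi, hη⟩ := exists_dominating hp (μ.restrict S)
      (θ := fun n x => ((n : ℝ≥0∞) + 1) * ρ n x) (fun n => (hρ n).1.const_mul _) (by
        refine lt_of_le_of_lt (ENNReal.tsum_le_tsum fun n => ?_) (hεs.trans ENNReal.one_lt_top)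
        rw [lintegral_const_mul_rpow hp.le _ _ (hρ n).1, mul_comm]
        exact (ENNReal.mul_lt_of_lt_div (hρε n)).le)
    refine ⟨η, hηm, hηi, fun γ hγ hfin => ?_⟩
    by_contra hP
    refine hfin (ENNReal.eq_top_of_forall_nnreal_le fun r => ?_)
    obtain ⟨n, hn⟩ := exists_nat_ge r
    calc (r : ℝ≥0∞) ≤ n := by exact_mod_cast hn
      _ ≤ ((n : ℝ≥0∞) + 1) * 1 := by simp
      _ ≤ ((n : ℝ≥0∞) + 1) * lineIntegral (ρ n) γ := by
        gcongr
        exact (hρ n).2 γ ⟨hγ, hP⟩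
      _ = lineIntegral (fun x => ((n : ℝ≥0∞) + 1) * ρ n x) γ :=
        (lineIntegral_const_mul _ (hρ n).1 γ).symm
      _ ≤ lineIntegral η γ := lintegral_mono fun r => hη n _
  · rintro ⟨η, hηm, hηi, hη⟩
    -- On exceptional curves `η` has infinite integral, so every multiple `η / n` is admissible. The
    -- case `n = 0` is harmless since `0⁻¹ = ∞`.
    have hle : ∀ n : ℕ, pModulus p μ S {γ ∈ Γ | ¬ P γ} ≤
        ((n : ℝ≥0∞)⁻¹) ^ p * ∫⁻ x in S, η x ^ p ∂μ := by
      intro n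
      rw [← lintegral_const_mul_rpow hp.le _ _ hηm]
      refine iInf₂_le_of_le (fun x => (n : ℝ≥0∞)⁻¹ * η x) ⟨hηm.const_mul _, fun γ hγ => ?_⟩ le_rfl
      have : lineIntegral η γ = ∞ := by
        by_contra h
        exact hγ.2 (hη γ hγ.1 h)
      rw [lineIntegral_const_mul _ hηm, this, ENNReal.mul_top (by simp)]
      exact le_top
    have hlim : Tendsto (fun n : ℕ => ((n : ℝ≥0∞)⁻¹) ^ p * ∫⁻ x in S, η x ^ p ∂μ) atTop (𝓝 0) := by
      have h1 : Tendsto (fun n : ℕ => ((n : ℝ≥0∞)⁻¹) ^ p) atTop (𝓝 0) := by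
        have := (ENNReal.continuous_rpow_const (y := p)).tendsto 0 |>.comp
          ENNReal.tendsto_inv_nat_nhds_zero
        rwa [ENNReal.zero_rpow_of_pos hp] at this
      simpa using ENNReal.Tendsto.mul_const h1 (Or.inr hηi.ne)
    exact le_antisymm (ge_of_tendsto' hlim hle) zero_le

/-- The energy of a weakly admissible density bounds the modulus. -/
theorem genModulus_le_of_isWeaklyAdmissible (hp : 1 ≤ p) {b : RectCurve X → ℝ≥0∞}
    {ρ : X → ℝ≥0∞} (hρ : IsWeaklyAdmissible p μ S Γ b ρ) :
    genModulus p μ S Γ b ≤ ∫⁻ x in S, ρ x ^ p ∂μ := by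
  have hp0 : 0 < p := by linarith
  obtain ⟨η, hηm, hηi, hη⟩ := (aeCurve_iff hp0).1 hρ.2
  have hB : (∫⁻ x in S, η x ^ p ∂μ) ^ (1 / p) ≠ ∞ :=
    ENNReal.rpow_ne_top_of_nonneg (by positivity) hηi.ne
  -- Adding a small multiple of `η` makes `ρ` admissible on every curve, and by Minkowski's
  -- inequality the added energy tends to zero.
  have hle : ∀ n : ℕ, genModulus p μ S Γ b ^ (1 / p) ≤ (∫⁻ x in S, ρ x ^ p ∂μ) ^ (1 / p) +
      (n : ℝ≥0∞)⁻¹ * (∫⁻ x in S, η x ^ p ∂μ) ^ (1 / p) := by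
    intro n
    have h1 : genModulus p μ S Γ b ≤ ∫⁻ x in S, (ρ x + (n : ℝ≥0∞)⁻¹ * η x) ^ p ∂μ := by
      refine iInf₂_le_of_le (fun x => ρ x + (n : ℝ≥0∞)⁻¹ * η x)
        ⟨hρ.1.add (hηm.const_mul _), fun γ hγ => ?_⟩ le_rfl
      rw [lineIntegral_add hρ.1, lineIntegral_const_mul _ hηm]
      by_cases h : lineIntegral η γ = ∞
      · rw [h, ENNReal.mul_top (by simp), add_top]
        exact le_top
      · exact (hη γ hγ h).trans le_self_add
    refine (ENNReal.rpow_le_rpow h1 (by positivity)).trans ?_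
    refine (ENNReal.lintegral_Lp_add_le (f := ρ) (g := fun x => (n : ℝ≥0∞)⁻¹ * η x)
      hρ.1.aemeasurable (hηm.const_mul _).aemeasurable hp).trans ?_
    rw [lintegral_const_mul_rpow hp0.le _ _ hηm, ENNReal.mul_rpow_of_nonneg _ _ (by positivity),
      ← ENNReal.rpow_mul, mul_one_div_cancel hp0.ne', ENNReal.rpow_one]
  have hlim : Tendsto (fun n : ℕ => (∫⁻ x in S, ρ x ^ p ∂μ) ^ (1 / p) +
      (n : ℝ≥0∞)⁻¹ * (∫⁻ x in S, η x ^ p ∂μ) ^ (1 / p)) atTop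
      (𝓝 ((∫⁻ x in S, ρ x ^ p ∂μ) ^ (1 / p))) := by
    have := ENNReal.Tendsto.mul_const ENNReal.tendsto_inv_nat_nhds_zero
      (b := (∫⁻ x in S, η x ^ p ∂μ) ^ (1 / p)) (Or.inr hB)
    simpa using tendsto_const_nhds.add this
  exact (ENNReal.rpow_le_rpow_iff (by positivity : 0 < 1 / p)).1 (ge_of_tendsto' hlim hle)

/-- On every subcurve of `γ`, the variation of `f` is bounded by the integral of `g`. -/
def HasVariationBound (f : X → EReal) (g : X → ℝ≥0∞) (γ : RectCurve X) : Prop :=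
  ∀ s t, 0 ≤ s → s < t → t ≤ γ.length →
    (f (γ.toFun s) - f (γ.toFun t)).abs ≤ ∫⁻ r in Icc s t, g (γ.toFun r)

omit [MeasurableSpace X] [BorelSpace X] in
theorem HasVariationBound.endpoints {f : X → EReal} {g : X → ℝ≥0∞} {γ : RectCurve X}
    (h : HasVariationBound f g γ) (hγ : 0 < γ.length) :
    (f γ.source - f γ.target).abs ≤ lineIntegral g γ :=
  h 0 γ.length le_rfl hγ le_rfl

omit [BorelSpace X] in
theorem IsUpperGradient.hasVariationBound {f : X → EReal} {g : X → ℝ≥0∞}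
    (h : IsUpperGradient S f g) {γ : RectCurve X} (hγ : γ ∈ curvesIn S) :
    HasVariationBound f g γ := by
  intro s t hs hst ht
  have := h.2 (γ.sub s t hs hst.le ht) (sub_mem_curvesIn hs hst.le ht fun r hr =>
    hγ r ⟨hs.trans hr.1, hr.2.trans ht⟩) (sub_pos.2 hst)
  rwa [RectCurve.source_sub, RectCurve.target_sub, lineIntegral_sub] at this

/-- A weak upper gradient of finite energy controls the function along all subcurves of all curves
on which a suitable density of finite energy has a finite integral. -/
theorem IsWeakUpperGradient.exists_density (hp : 1 ≤ p) {f : X → EReal} {g : X → ℝ≥0∞}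
    (h : IsWeakUpperGradient p μ S f g) (hg : ∫⁻ x in S, g x ^ p ∂μ < ∞) :
    ∃ η : X → ℝ≥0∞, Measurable η ∧ ∫⁻ x in S, η x ^ p ∂μ < ∞ ∧ (∀ x, g x ≤ η x) ∧
      ∀ γ : RectCurve X, ∀ s t, (hs : 0 ≤ s) → (hst : s < t) → (ht : t ≤ γ.length) →
        (∀ r ∈ Icc s t, γ.toFun r ∈ S) → ∫⁻ r in Icc s t, η (γ.toFun r) ≠ ∞ →
        (f (γ.toFun s) - f (γ.toFun t)).abs ≤ ∫⁻ r in Icc s t, g (γ.toFun r) := by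
  obtain ⟨η, hηm, hηi, hη⟩ := (aeCurve_iff (by linarith)).1 h.2
  -- Including `g` in the density lets one finiteness condition also control the integral of `g`.
  refine ⟨fun x => g x + η x, h.1.add hηm, lintegral_add_rpow_lt_top hp h.1 hg hηi,
    fun x => le_self_add, fun γ s t hs hst ht hS hfin => ?_⟩
  have := hη (γ.sub s t hs hst.le ht) ⟨sub_mem_curvesIn hs hst.le ht hS, sub_pos.2 hst⟩ ?_
  · rwa [RectCurve.source_sub, RectCurve.target_sub, lineIntegral_sub] at this
  · rw [lineIntegral_sub]
    exact ne_top_of_le_ne_top hfin (lintegral_mono fun r => le_add_self)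

theorem EReal.ne_top_bot_of_abs_sub_ne_top {x y : EReal} (h : (x - y).abs ≠ ∞) :
    (x ≠ ⊤ ∧ x ≠ ⊥) ∧ (y ≠ ⊤ ∧ y ≠ ⊥) := by
  induction x <;> induction y <;> simp_all

-- The convention `|∞ - ∞| = ∞` is what works here: an infinite value at one point of the curve
-- gives an infinite variation against any other point, which a finite integral forbids. The end
-- point is compared with the start, every other point with the end point.
omit [MeasurableSpace X] [BorelSpace X] in
theorem HasVariationBound.ne_top_bot {f : X → EReal} {g : X → ℝ≥0∞} {γ : RectCurve X}
    (h : HasVariationBound f g γ) (hγ : 0 < γ.length) (hg : lineIntegral g γ ≠ ∞)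
    {t : ℝ} (ht : t ∈ Icc 0 γ.length) : f (γ.toFun t) ≠ ⊤ ∧ f (γ.toFun t) ≠ ⊥ := by
  have hfin : ∀ s t, 0 ≤ s → s < t → t ≤ γ.length →
      (f (γ.toFun s) - f (γ.toFun t)).abs ≠ ∞ := fun s t hs hst ht =>
    ne_top_of_le_ne_top hg ((h s t hs hst ht).trans
      (lintegral_mono_set (Icc_subset_Icc hs ht)))
  rcases ht.2.eq_or_lt with h1 | h1
  · exact (EReal.ne_top_bot_of_abs_sub_ne_top
      (hfin 0 t le_rfl (by rwa [h1]) ht.2)).2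
  · exact (EReal.ne_top_bot_of_abs_sub_ne_top (hfin t γ.length ht.1 h1 le_rfl)).1

theorem EReal.abs_sub_eq_ofReal {x y : EReal} (hx : x ≠ ⊤ ∧ x ≠ ⊥) (hy : y ≠ ⊤ ∧ y ≠ ⊥) :
    (x - y).abs = ENNReal.ofReal |x.toReal - y.toReal| := by
  lift x to ℝ using hx
  lift y to ℝ using hy
  rw [← EReal.coe_sub, EReal.abs_def]
  simp

omit [MeasurableSpace X] [BorelSpace X] in
theorem HasVariationBound.ofReal_le {f : X → EReal} {g : X → ℝ≥0∞} {γ : RectCurve X}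
    (h : HasVariationBound f g γ) (hγ : 0 < γ.length) (hg : lineIntegral g γ ≠ ∞)
    (s t : ℝ) (hs : 0 ≤ s) (hst : s ≤ t) (ht : t ≤ γ.length) :
    ENNReal.ofReal |(f (γ.toFun s)).toReal - (f (γ.toFun t)).toReal| ≤
      ∫⁻ r in Icc s t, g (γ.toFun r) := by
  rcases hst.eq_or_lt with rfl | hlt
  · simp
  · rw [← EReal.abs_sub_eq_ofReal (h.ne_top_bot hγ hg ⟨hs, hst.trans ht⟩)
      (h.ne_top_bot hγ hg ⟨hs.trans hst, ht⟩)]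
    exact h s t hs hlt ht

theorem IsWeakUpperGradient.exists_density_curve (hp : 1 ≤ p) {f : X → EReal} {g : X → ℝ≥0∞}
    (h : IsWeakUpperGradient p μ S f g) (hg : ∫⁻ x in S, g x ^ p ∂μ < ∞) :
    ∃ η : X → ℝ≥0∞, Measurable η ∧ ∫⁻ x in S, η x ^ p ∂μ < ∞ ∧ (∀ x, g x ≤ η x) ∧
      ∀ γ ∈ curvesIn S, lineIntegral η γ ≠ ∞ → HasVariationBound f g γ := by
  obtain ⟨η, hηm, hηi, hle, hη⟩ := h.exists_density hp hg
  refine ⟨η, hηm, hηi, hle, fun γ hγ hfin s t hs hst ht => ?_⟩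
  exact hη γ s t hs hst ht (fun r hr => hγ r ⟨hs.trans hr.1, hr.2.trans ht⟩)
    (ne_top_of_le_ne_top hfin (lintegral_mono_set (Icc_subset_Icc hs ht)))

theorem isWeakUpperGradient_of_density (hp : 0 < p) {f : X → EReal} {g η : X → ℝ≥0∞}
    (hgm : Measurable g) (hηm : Measurable η) (hη : ∫⁻ x in S, η x ^ p ∂μ < ∞)
    (h : ∀ γ ∈ curvesIn S, 0 < γ.length → lineIntegral η γ ≠ ∞ →
      (f γ.source - f γ.target).abs ≤ lineIntegral g γ) : IsWeakUpperGradient p μ S f g :=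
  ⟨hgm, (aeCurve_iff hp).2 ⟨η, hηm, hη, fun γ hγ => h γ hγ.1 hγ.2⟩⟩

/-- The minimum of two weak upper gradients of finite energy is a weak upper gradient. -/
theorem IsWeakUpperGradient.min (hp : 1 ≤ p) {f : X → EReal} {g g' : X → ℝ≥0∞}
    (h : IsWeakUpperGradient p μ S f g) (hg : ∫⁻ x in S, g x ^ p ∂μ < ∞)
    (h' : IsWeakUpperGradient p μ S f g') (hg' : ∫⁻ x in S, g' x ^ p ∂μ < ∞) :
    IsWeakUpperGradient p μ S f (fun x => min (g x) (g' x)) := by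
  obtain ⟨η, hηm, hηi, hle, hη⟩ := h.exists_density_curve hp hg
  obtain ⟨η', hηm', hηi', hle', hη'⟩ := h'.exists_density_curve hp hg'
  refine isWeakUpperGradient_of_density (by linarith) (h.1.min h'.1) (hηm.add hηm')
    (lintegral_add_rpow_lt_top hp hηm hηi hηi') fun γ hγ hpos hfin => ?_
  have hfin' : lineIntegral (fun x => η x + η' x) γ ≠ ∞ := hfin
  rw [lineIntegral_add hηm, ENNReal.add_ne_top] at hfin'
  have b := hη γ hγ hfin'.1
  have b' := hη' γ hγ hfin'.2
  have f1 : lineIntegral g γ ≠ ∞ :=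
    ne_top_of_le_ne_top hfin'.1 (lintegral_mono fun r => hle _)
  have f2 : lineIntegral g' γ ≠ ∞ :=
    ne_top_of_le_ne_top hfin'.2 (lintegral_mono fun r => hle' _)
  rw [RectCurve.source, RectCurve.target, EReal.abs_sub_eq_ofReal
    (b.ne_top_bot hpos f1 ⟨le_rfl, hpos.le⟩) (b.ne_top_bot hpos f1 ⟨hpos.le, le_rfl⟩)]
  exact ofReal_abs_sub_le_lintegral_min (h := fun t => (f (γ.toFun t)).toReal) hpos.le
    (γ.aemeasurable_comp h.1) f1 (b.ofReal_le hpos f1)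
    (γ.aemeasurable_comp h'.1) f2 (b'.ofReal_le hpos f2)

/-- The limit of a decreasing sequence of weak upper gradients of finite energy is a weak upper
gradient. -/
theorem isWeakUpperGradient_iInf (hp : 1 ≤ p) {f : X → EReal} {G : ℕ → X → ℝ≥0∞}
    (hanti : Antitone G) (h : ∀ n, IsWeakUpperGradient p μ S f (G n))
    (hG : ∀ n, ∫⁻ x in S, G n x ^ p ∂μ < ∞) :
    IsWeakUpperGradient p μ S f (fun x => ⨅ n, G n x) := by
  have hp0 : 0 < p := by linarith
  choose η hηm hηi hle hη using fun n => (h n).exists_density_curve hp (hG n)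
  obtain ⟨ε, hε, hεs⟩ := ENNReal.exists_pos_sum_of_countable (ε := 1) one_ne_zero ℕ
  -- The positive weights `c n` make the energies of `c n * η n` summable. Finiteness of the
  -- integral of one dominating density `θ` then forces finiteness for every `η n` simultaneously.
  have hc : ∀ n, ∃ c : ℝ≥0∞, c ≠ 0 ∧ c ^ p * ∫⁻ x in S, η n x ^ p ∂μ ≤ ε n := by
    intro n
    have hlim : Tendsto (fun k : ℕ => ((k : ℝ≥0∞)⁻¹) ^ p * ∫⁻ x in S, η n x ^ p ∂μ) atTop
        (𝓝 0) := by
      have h1 : Tendsto (fun n : ℕ => ((n : ℝ≥0∞)⁻¹) ^ p) atTop (𝓝 0) := by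
        have := (ENNReal.continuous_rpow_const (y := p)).tendsto 0 |>.comp
          ENNReal.tendsto_inv_nat_nhds_zero
        rwa [ENNReal.zero_rpow_of_pos hp0] at this
      simpa using ENNReal.Tendsto.mul_const h1 (Or.inr (hηi n).ne)
    obtain ⟨k, hk⟩ := (hlim.eventually (eventually_le_nhds (ENNReal.coe_pos.2 (hε n)))).exists
    exact ⟨(k : ℝ≥0∞)⁻¹, by simp, hk⟩
  choose c hc0 hc using hc
  obtain ⟨θ, hθm, hθi, hθ⟩ := exists_dominating hp0 (μ.restrict S)
    (θ := fun n x => c n * η n x) (fun n => (hηm n).const_mul _) (by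
      refine lt_of_le_of_lt (ENNReal.tsum_le_tsum fun n => ?_) (hεs.trans ENNReal.one_lt_top)
      rw [lintegral_const_mul_rpow hp0.le _ _ (hηm n)]
      exact hc n)
  refine isWeakUpperGradient_of_density hp0 (Measurable.iInf fun n => (h n).1) hθm hθi
    fun γ hγ hpos hfin => ?_
  have hηfin : ∀ n, lineIntegral (η n) γ ≠ ∞ := by
    intro n htop
    have h1 : lineIntegral (fun x => c n * η n x) γ ≤ lineIntegral θ γ :=
      lintegral_mono fun r => hθ n _
    rw [lineIntegral_const_mul _ (hηm n), htop, ENNReal.mul_top (hc0 n), top_le_iff] at h1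
    exact hfin h1
  have heq : lineIntegral (fun x => ⨅ n, G n x) γ = ⨅ n, lineIntegral (G n) γ := by
    refine lintegral_iInf' (fun n => γ.aemeasurable_comp (h n).1)
      (Eventually.of_forall fun r m n hmn => hanti hmn _) ?_
    exact ne_top_of_le_ne_top (hηfin 0) (lintegral_mono fun r => hle 0 _)
  rw [heq]
  exact le_iInf fun n => (hη n γ hγ (hηfin n)).endpoints hpos

/-- Every function with a weak upper gradient of finite energy has a minimal one. -/
theorem exists_isMinimalWeakUpperGradient (hp : 1 ≤ p) {f : X → EReal} {g₀ : X → ℝ≥0∞}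
    (h₀ : IsWeakUpperGradient p μ S f g₀) (hg₀ : ∫⁻ x in S, g₀ x ^ p ∂μ < ∞) :
    ∃ g : X → ℝ≥0∞, IsMinimalWeakUpperGradient p μ S f g := by
  have hp0 : 0 < p := by linarith
  let W : Set (X → ℝ≥0∞) := {g | IsWeakUpperGradient p μ S f g ∧ ∫⁻ x in S, g x ^ p ∂μ < ∞}
  let E : (X → ℝ≥0∞) → ℝ≥0∞ := fun g => ∫⁻ x in S, g x ^ p ∂μ
  have hne : (E '' W).Nonempty := ⟨_, g₀, ⟨h₀, hg₀⟩, rfl⟩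
  obtain ⟨a, -, ha, haW⟩ := exists_seq_tendsto_sInf hne (OrderBot.bddBelow _)
  choose G hGW hGa using haW
  -- Running minima of a minimizing sequence are still weak upper gradients and still minimizing,
  -- but now decrease, so their limit is a weak upper gradient.
  let H : ℕ → X → ℝ≥0∞ := fun n => Nat.rec (G 0) (fun k K x => min (K x) (G (k + 1) x)) n
  have hH : ∀ n, H n ∈ W ∧ H n ≤ G n := by
    intro n
    induction n with
    | zero => exact ⟨hGW 0, le_rfl⟩
    | succ n ih =>
      have hle : H (n + 1) ≤ G (n + 1) := fun x => min_le_right _ _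
      exact ⟨⟨ih.1.1.min hp ih.1.2 (hGW (n + 1)).1 (hGW (n + 1)).2,
        (lintegral_mono fun x => ENNReal.rpow_le_rpow (hle x) hp0.le).trans_lt
          (hGW (n + 1)).2⟩, hle⟩
  have hanti : Antitone H := antitone_nat_of_succ_le fun n x => min_le_left _ _
  let g : X → ℝ≥0∞ := fun x => ⨅ n, H n x
  have hgw : IsWeakUpperGradient p μ S f g :=
    isWeakUpperGradient_iInf hp hanti (fun n => (hH n).1.1) fun n => (hH n).1.2
  have hgle : E g ≤ sInf (E '' W) := by
    refine ge_of_tendsto' ha fun n => ?_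
    rw [← hGa n]
    exact lintegral_mono fun x =>
      ENNReal.rpow_le_rpow ((iInf_le _ n).trans ((hH n).2 x)) hp0.le
  have hgfin : E g < ∞ :=
    (lintegral_mono fun x => ENNReal.rpow_le_rpow (iInf_le _ 0) hp0.le).trans_lt (hH 0).1.2
  refine ⟨g, hgw, hgfin, fun g' hg' hg'fin => ?_⟩
  -- The minimum with any `g'` is again in the class, so it cannot have less energy than `g` and
  -- must agree with `g` almost everywhere.
  have hmin := hgw.min hp hgfin hg' hg'fin
  have hmle : ∀ x, min (g x) (g' x) ^ p ≤ g x ^ p := fun x =>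
    ENNReal.rpow_le_rpow (min_le_left _ _) hp0.le
  have hminfin : E (fun x => min (g x) (g' x)) < ∞ := (lintegral_mono hmle).trans_lt hgfin
  have hae := ae_eq_of_ae_le_of_lintegral_le (μ := μ.restrict S) (Eventually.of_forall hmle)
    hminfin.ne (hgw.1.pow_const p).aemeasurable
    (hgle.trans (sInf_le ⟨_, ⟨hmin, hminfin⟩, rfl⟩))
  filter_upwards [hae] with x hx
  rw [← (ENNReal.rpow_left_injective hp0.ne') hx]
  exact min_le_right _ _

/-- A weak upper gradient of finite energy can be increased to an upper gradient. -/
theorem IsWeakUpperGradient.exists_isUpperGradient (hp : 1 ≤ p) {f : X → EReal} {g : X → ℝ≥0∞}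
    (h : IsWeakUpperGradient p μ S f g) (hg : ∫⁻ x in S, g x ^ p ∂μ < ∞) :
    ∃ η : X → ℝ≥0∞, IsUpperGradient S f η ∧ ∫⁻ x in S, η x ^ p ∂μ < ∞ := by
  obtain ⟨η, hηm, hηi, hle, hη⟩ := h.exists_density_curve hp hg
  refine ⟨η, ⟨hηm, fun γ hγ hpos => ?_⟩, hηi⟩
  by_cases hfin : lineIntegral η γ = ∞
  · rw [hfin]
    exact le_top
  · exact ((hη γ hγ hfin).endpoints hpos).trans (lintegral_mono fun r => hle _)

end

/-! ### Universal measurability of analytic sets -/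

section

/-- Inner regularity of analytic sets with respect to compact sets. -/
theorem exists_isCompact_lt_measure_range {X : Type*} [TopologicalSpace X]
    [MeasurableSpace X] (μ : Measure X) [μ.OuterRegular]
    {f : (ℕ → ℕ) → X} (hf : Continuous f) {c : ℝ≥0∞} (hc : c < μ (range f)) :
    ∃ K ⊆ range f, IsCompact K ∧ c ≤ μ K := by
  -- Continuity from below holds for increasing unions of arbitrary sets, so one more coordinate can
  -- be bounded while the measure of the image stays above `c`.
  have step : ∀ (k : ℕ) (A : Set (ℕ → ℕ)), c < μ (f '' A) →
      ∃ m : ℕ, c < μ (f '' (A ∩ {x | x k ≤ m})) := by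
    intro k A hA
    have hU : f '' A = ⋃ m : ℕ, f '' (A ∩ {x | x k ≤ m}) := by
      rw [← image_iUnion, ← inter_iUnion]
      congr 1
      ext x
      simp only [mem_inter_iff, mem_iUnion, mem_ofPred_eq, iff_self_and]
      exact fun _ => ⟨x k, le_rfl⟩
    have hmono : Monotone fun m : ℕ => f '' (A ∩ {x | x k ≤ m}) := by
      intro m n hmn
      exact image_mono (inter_subset_inter_right _ fun x (hx : x k ≤ m) => hx.trans hmn)
    rw [hU, hmono.measure_iUnion] at hA
    exact lt_iSup_iff.1 hA
  choose! m hm using step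
  let A : ℕ → Set (ℕ → ℕ) := fun n =>
    Nat.rec univ (fun k B => B ∩ {x | x k ≤ m k B}) n
  have hA : ∀ k, c < μ (f '' A k) := by
    intro k
    induction k with
    | zero => simpa [A] using hc
    | succ k ih => exact hm k _ ih
  have hAi : ∀ k, ∀ x ∈ A k, ∀ i < k, x i ≤ m i (A i) := by
    intro k
    induction k with
    | zero => intro x _ i hi; omega
    | succ k ih =>
      intro x hx i hi
      rcases Nat.lt_succ_iff_lt_or_eq.1 hi with h | rfl
      · exact ih x hx.1 i h
      · exact hx.2
  let C : Set (ℕ → ℕ) := univ.pi fun i => Iic (m i (A i))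
  have hC : IsCompact C := isCompact_univ_pi fun i => (finite_Iic _).isCompact
  refine ⟨f '' C, image_subset_range _ _, hC.image hf, ?_⟩
  -- By outer regularity it suffices that every open set containing the image of the compact box `C`
  -- contains the image of some `A k`, which has measure above `c`.
  rw [(f '' C).measure_eq_iInf_isOpen]
  refine le_iInf₂ fun U hU => le_iInf fun hUo => ?_
  suffices h : ∃ k, f '' A k ⊆ U by
    obtain ⟨k, hk⟩ := h
    exact (hA k).le.trans (measure_mono hk)
  by_contra! h
  have h' : ∀ k, ∃ x ∈ A k, f x ∉ U := by
    intro k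
    obtain ⟨_, ⟨x, hx, rfl⟩, hxU⟩ := not_subset.1 (h k)
    exact ⟨x, hx, hxU⟩
  choose x hxA hxU using h'
  -- Clipping moves the points `x k` into `C` without changing their coordinates below `k`. A limit
  -- of the clipped points along a subsequence is thus also a limit of the `x k`, and its image lies
  -- both in `U` and in the closed complement.
  let y : ℕ → ℕ → ℕ := fun k i => min (x k i) (m i (A i))
  have hyC : ∀ k, y k ∈ C := fun k i _ => mem_Iic.2 (min_le_right _ _)
  obtain ⟨z, hz, φ, hφ, hlim⟩ := hC.tendsto_subseq hyC
  have hlim' : Tendsto (x ∘ φ) atTop (𝓝 z) := by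
    rw [tendsto_pi_nhds] at hlim ⊢
    intro i
    refine (hlim i).congr' ?_
    filter_upwards [eventually_gt_atTop i] with k hk
    exact min_eq_left (hAi _ _ (hxA _) i (hk.trans_le (hφ.id_le k)))
  have : f z ∈ Uᶜ := hUo.isClosed_compl.mem_of_tendsto ((hf.tendsto z).comp hlim')
    (Eventually.of_forall fun k => hxU _)
  exact this (hU ⟨z, hz, rfl⟩)

/-- Analytic sets are universally measurable. -/
theorem nullMeasurableSet_of_analyticSet {X : Type*} [TopologicalSpace X] [T2Space X]
    [MeasurableSpace X] [OpensMeasurableSpace X] (μ : Measure X) [μ.OuterRegular]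
    [IsFiniteMeasure μ] {s : Set X} (hs : AnalyticSet s) : NullMeasurableSet s μ := by
  rw [AnalyticSet] at hs
  rcases hs with rfl | ⟨f, hf, rfl⟩
  · exact nullMeasurableSet_empty
  rcases eq_or_ne (μ (range f)) 0 with h0 | h0
  · exact NullMeasurableSet.of_null h0
  obtain ⟨c, -, hc, hlim⟩ := exists_seq_strictMono_tendsto' (pos_iff_ne_zero.2 h0)
  choose K hKs hK hcK using fun n => exists_isCompact_lt_measure_range μ hf (hc n).2
  let T := ⋃ n, K n
  have hT : MeasurableSet T := MeasurableSet.iUnion fun n => (hK n).measurableSet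
  have hTs : T ⊆ range f := iUnion_subset hKs
  have hle : μ (range f) ≤ μ T :=
    le_of_tendsto' hlim fun n => (hcK n).trans (measure_mono (subset_iUnion K n))
  -- The range is squeezed between a countable union of compact sets and its measurable hull, which
  -- have the same measure.
  have hae : T =ᵐ[μ] toMeasurable μ (range f) :=
    ae_eq_of_subset_of_measure_ge (hTs.trans (subset_toMeasurable _ _))
      (by rwa [measure_toMeasurable]) hT.nullMeasurableSet (measure_ne_top _ _)
  refine hT.nullMeasurableSet.congr ?_
  refine (LE.le.eventuallyLE hTs).antisymm ?_
  exact (LE.le.eventuallyLE (subset_toMeasurable μ _)).trans hae.symm.le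

end

/-! ### Measurability of the least cost of reaching a point -/

section

open scoped unitInterval

theorem setLIntegral_Icc_comp_mul {l : ℝ} (hl : 0 < l) (F : ℝ → ℝ≥0∞) :
    ∫⁻ t in Icc 0 l, F t = ENNReal.ofReal l * ∫⁻ t in Icc 0 1, F (l * t) := by
  have hemb : MeasurableEmbedding fun t : ℝ => l * t :=
    (Homeomorph.mulLeft₀ l hl.ne').measurableEmbedding
  have hpre : (fun t : ℝ => l * t) ⁻¹' Icc 0 l = Icc 0 1 := by
    ext t
    simp only [mem_preimage, mem_Icc, mul_nonneg_iff_of_pos_left hl,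
      mul_le_iff_le_one_right hl]
  conv_lhs => rw [← Real.smul_map_volume_mul_left hl.ne']
  rw [Measure.restrict_smul, lintegral_smul_measure, abs_of_pos hl, smul_eq_mul, hemb.restrict_map,
    hpre, hemb.lintegral_map]

variable {X : Type*} [MetricSpace X]

/-- The least cost of reaching `x` in `S` from `B`, where starting at `y` costs `a y` and travelling
along a curve costs the integral of `ρ`. -/
noncomputable def reachCost (a ρ : X → ℝ≥0∞) (S B : Set X) (x : X) : ℝ≥0∞ :=
  ⨅ (γ : RectCurve X) (_ : γ ∈ curvesIn S ∧ γ.source ∈ B ∧ γ.target = x),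
    a γ.source + lineIntegral ρ γ

/-- The pairs `(l, w)` where `w` is a parametrization on the unit interval with constant speed `l`
of a curve in `S` that starts in `B` and has cost less than `c`. -/
def speedCurves (a ρ : X → ℝ≥0∞) (S B : Set X) (c : ℝ≥0∞) : Set (ℝ × C(I, X)) :=
  {q | 0 ≤ q.1} ∩ {q | ∀ s t : I, dist (q.2 s) (q.2 t) ≤ q.1 * dist s t} ∩
    {q | ENNReal.ofReal q.1 ≤ eVariationOn q.2 univ} ∩ {q | ∀ t, q.2 t ∈ S} ∩ {q | q.2 0 ∈ B} ∩
    {q | a (q.2 0) + ENNReal.ofReal q.1 * ∫⁻ t in Icc (0 : ℝ) 1,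
      ρ (q.2 (projIcc 0 1 zero_le_one t)) < c}

/-- The parametrization of a curve on the unit interval. -/
noncomputable def RectCurve.toContinuousMap (γ : RectCurve X) : C(I, X) where
  toFun t := γ.toFun (γ.length * t)
  continuous_toFun := γ.continuousOn.comp_continuous (by fun_prop) fun t =>
    ⟨mul_nonneg γ.length_nonneg t.2.1, mul_le_of_le_one_right γ.length_nonneg t.2.2⟩

theorem RectCurve.mem_speedCurves {a ρ : X → ℝ≥0∞} {S B : Set X} {c : ℝ≥0∞} (γ : RectCurve X)
    (hγ : γ ∈ curvesIn S) (hB : γ.source ∈ B) (hc : a γ.source + lineIntegral ρ γ < c) :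
    (γ.length, γ.toContinuousMap) ∈ speedCurves a ρ S B c := by
  have hmem : ∀ t : I, γ.length * t ∈ Icc 0 γ.length := fun t =>
    ⟨mul_nonneg γ.length_nonneg t.2.1, mul_le_of_le_one_right γ.length_nonneg t.2.2⟩
  have hmono : Monotone fun t : I => γ.length * (t : ℝ) := fun s t hst =>
    mul_le_mul_of_nonneg_left hst γ.length_nonneg
  have hsource : γ.toContinuousMap 0 = γ.source := by
    simp [toContinuousMap, source]
  refine ⟨⟨⟨⟨⟨γ.length_nonneg, ?_⟩, ?_⟩, fun t => hγ _ (hmem t)⟩, ?_⟩, ?_⟩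
  · have key : ∀ s t : I, s ≤ t → dist (γ.toContinuousMap s) (γ.toContinuousMap t) ≤
        γ.length * dist s t := by
      intro s t hst
      have h := γ.edist_le (hmem s).1 (hmono hst) (hmem t).2
      rw [edist_dist, ENNReal.ofReal_le_ofReal_iff (sub_nonneg.2 (hmono hst))] at h
      refine h.trans (le_of_eq ?_)
      rw [Subtype.dist_eq, Real.dist_eq, abs_sub_comm,
        abs_of_nonneg (sub_nonneg.2 (Subtype.coe_le_coe.2 hst)), mul_sub]
    intro s t
    rcases le_total s t with h | h
    · exact key s t h
    · have := key t s h
      rwa [dist_comm, dist_comm t s] at this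
  · have h := eVariationOn.comp_eq_of_monotoneOn γ.toFun (t := univ)
      (fun t : I => γ.length * (t : ℝ)) (hmono.monotoneOn _)
    have himg : (fun t : I => γ.length * (t : ℝ)) '' univ = Icc 0 γ.length := by
      apply Subset.antisymm
      · rintro _ ⟨t, -, rfl⟩
        exact hmem t
      · intro r hr
        rcases γ.length_nonneg.eq_or_lt with h0 | h0
        · refine ⟨0, mem_univ _, ?_⟩
          rw [← h0] at hr ⊢
          simpa using (le_antisymm hr.2 hr.1).symm
        · exact ⟨⟨r / γ.length, div_nonneg hr.1 h0.le, div_le_one_of_le₀ hr.2 h0.le⟩, mem_univ _,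
            mul_div_cancel₀ r h0.ne'⟩
    rw [himg, γ.arcLength _ ⟨γ.length_nonneg, le_rfl⟩] at h
    exact h.ge
  · rw [mem_ofPred_eq, hsource]
    exact hB
  · rw [mem_ofPred_eq, hsource]
    refine lt_of_eq_of_lt ?_ hc
    congr 1
    rcases γ.length_nonneg.eq_or_lt with h0 | h0
    · simp [lineIntegral, ← h0]
    · rw [lineIntegral, setLIntegral_Icc_comp_mul h0]
      congr 1
      refine setLIntegral_congr_fun measurableSet_Icc fun t ht => ?_
      simp [toContinuousMap, projIcc_of_mem zero_le_one ht]

/-- The Lipschitz bound limits the variation on each subinterval, while the total variation is at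
least `l`. No subinterval can then fall short, so rescaling time by `l` gives an arc-length
parametrization. For `l = 0` the curve is constant. -/
theorem exists_rectCurve_of_mem_speedCurves {a ρ : X → ℝ≥0∞} {S B : Set X} {c : ℝ≥0∞}
    {q : ℝ × C(I, X)} (hq : q ∈ speedCurves a ρ S B c) :
    ∃ γ ∈ curvesIn S, γ.source ∈ B ∧ γ.target = q.2 1 ∧ a γ.source + lineIntegral ρ γ < c := by
  obtain ⟨l, w⟩ := q
  obtain ⟨⟨⟨⟨⟨hl, hlip⟩, hvar⟩, hS⟩, hB⟩, hc⟩ := hq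
  simp only [mem_ofPred_eq] at hl hlip hvar hS hB hc
  rcases hl.eq_or_lt with rfl | hl
  · refine ⟨RectCurve.const (w 0), fun t _ => hS 0, hB, ?_, ?_⟩
    · have := hlip 0 1
      rw [zero_mul] at this
      exact dist_le_zero.1 this
    · rw [lineIntegral_const]
      simpa [RectCurve.const, RectCurve.source] using hc
  let F : ℝ → X := fun t => w (projIcc 0 1 zero_le_one (t / l))
  have hFlip : LipschitzOnWith 1 F univ := by
    refine LipschitzOnWith.of_dist_le_mul fun s _ t _ => ?_
    refine (hlip _ _).trans ?_
    have h1 : dist (projIcc (0 : ℝ) 1 zero_le_one (s / l)) (projIcc 0 1 zero_le_one (t / l)) ≤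
        dist (s / l) (t / l) := by
      have := (LipschitzWith.projIcc (zero_le_one (α := ℝ))).dist_le_mul (s / l) (t / l)
      simpa using this
    calc l * dist (projIcc (0 : ℝ) 1 zero_le_one (s / l)) (projIcc 0 1 zero_le_one (t / l))
        ≤ l * dist (s / l) (t / l) := by gcongr
      _ = ((1 : ℝ≥0) : ℝ) * dist s t := by
        rw [Real.dist_eq, Real.dist_eq, ← sub_div, abs_div, abs_of_pos hl,
          mul_div_cancel₀ _ hl.ne', NNReal.coe_one, one_mul]
  have hFvar : ∀ s t, s ≤ t → eVariationOn F (Icc s t) ≤ ENNReal.ofReal (t - s) := by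
    intro s t hst
    have h1 := hFlip.comp_eVariationOn_le (g := id) (s := Icc s t) (mapsTo_univ _ _)
    have h2 := (monotone_id.monotoneOn (Icc s t)).eVariationOn_eq (left_mem_Icc.2 hst)
      (right_mem_Icc.2 hst)
    rw [inter_self] at h2
    simpa using h1.trans (mul_le_mul_right h2.le _)
  have htot : ENNReal.ofReal l ≤ eVariationOn F (Icc 0 l) := by
    have h := eVariationOn.comp_eq_of_monotoneOn w (t := Icc 0 l)
      (fun t => projIcc (0 : ℝ) 1 zero_le_one (t / l))
      (((monotone_projIcc _).comp fun s t hst => by gcongr).monotoneOn _)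
    have himg : (fun t => projIcc (0 : ℝ) 1 zero_le_one (t / l)) '' Icc 0 l = univ := by
      refine eq_univ_of_forall fun r => ⟨l * r, ⟨mul_nonneg hl.le r.2.1,
        mul_le_of_le_one_right hl.le r.2.2⟩, ?_⟩
      simp only [mul_div_cancel_left₀ (r : ℝ) hl.ne', projIcc_val]
    rw [himg] at h
    exact hvar.trans h.ge
  let γ : RectCurve X :=
    { toFun := F
      length := l
      length_nonneg := hl.le
      arcLength := fun t ht => by
        refine le_antisymm (by simpa using hFvar 0 t ht.1) ?_
        have h1 := eVariationOn.Icc_add_Icc F (s := univ) ht.1 ht.2 (mem_univ t)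
        simp only [univ_inter] at h1
        have h2 : ENNReal.ofReal l ≤ eVariationOn F (Icc 0 t) + ENNReal.ofReal (l - t) := by
          refine htot.trans ?_
          rw [← h1]
          gcongr
          exact hFvar t l ht.2
        have h3 : ENNReal.ofReal l = ENNReal.ofReal t + ENNReal.ofReal (l - t) := by
          rw [← ENNReal.ofReal_add ht.1 (sub_nonneg.2 ht.2), add_sub_cancel]
        rw [h3] at h2
        exact (ENNReal.add_le_add_iff_right ENNReal.ofReal_ne_top).1 h2 }
  have hsource : γ.source = w 0 := by
    simp [γ, RectCurve.source, F]
  refine ⟨γ, fun t _ => hS _, hsource ▸ hB, ?_, ?_⟩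
  · simp [γ, RectCurve.target, F, div_self hl.ne']
  · rw [hsource, lineIntegral, show γ.length = l from rfl, setLIntegral_Icc_comp_mul hl]
    simpa [γ, F, mul_div_cancel_left₀ _ hl.ne'] using hc

/-- An infimum is below `c` exactly when some curve costs less than `c`, so no optimal curve is
needed. Constant speed on the unit interval places curves of all lengths in one function space, and
the sublevel set becomes a projection. -/
theorem setOf_reachCost_lt (a ρ : X → ℝ≥0∞) (S B : Set X) (c : ℝ≥0∞) :
    {x | reachCost a ρ S B x < c} = (fun q : ℝ × C(I, X) => q.2 1) '' speedCurves a ρ S B c := by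
  ext x
  simp only [mem_ofPred_eq, reachCost, iInf_lt_iff, mem_image]
  constructor
  · rintro ⟨γ, ⟨hγ, hB, hx⟩, hc⟩
    refine ⟨_, γ.mem_speedCurves hγ hB hc, ?_⟩
    simpa [RectCurve.toContinuousMap, RectCurve.target] using hx
  · rintro ⟨q, hq, rfl⟩
    obtain ⟨γ, hγ, hB, ht, hc⟩ := exists_rectCurve_of_mem_speedCurves hq
    exact ⟨γ, ⟨hγ, hB, ht⟩, hc⟩

variable [MeasurableSpace X] [BorelSpace X]

/-- The space of pairs is Polish and each condition on them is Borel: most are closed, the length is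
lower semicontinuous in the curve, and the cost integral is measurable by Tonelli's theorem because
evaluation is jointly continuous. The end point map is continuous, so the image is analytic. -/
theorem analyticSet_reachCost_lt [CompleteSpace X] [SecondCountableTopology X] {a ρ : X → ℝ≥0∞}
    (ha : Measurable a) (hρ : Measurable ρ) {S B : Set X} (hS : IsClosed S) (hB : IsClosed B)
    (c : ℝ≥0∞) : AnalyticSet {x | reachCost a ρ S B x < c} := by
  let _ : MeasurableSpace C(I, X) := borel _
  have : BorelSpace C(I, X) := ⟨rfl⟩
  rw [setOf_reachCost_lt]
  have hev : ∀ t : I, Continuous fun q : ℝ × C(I, X) => q.2 t := fun t => by fun_prop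
  refine MeasurableSet.analyticSet_image ?_ (hev 1).measurable
  refine (((((?_ : MeasurableSet _).inter ?_).inter ?_).inter ?_).inter ?_).inter ?_
  · exact (isClosed_le continuous_const continuous_fst).measurableSet
  · simp only [ofPred_forall]
    refine (isClosed_iInter fun s => isClosed_iInter fun t => ?_).measurableSet
    exact isClosed_le ((hev s).dist (hev t)) (by fun_prop)
  · refine measurableSet_le (by fun_prop) ?_
    have hlsc : LowerSemicontinuous fun w : C(I, X) => eVariationOn w univ := by
      intro w v hv
      refine eVariationOn.lowerSemicontinuous_aux (F := fun τ : C(I, X) => (τ : I → X))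
        (fun t _ => ?_) hv
      exact (continuous_eval_const (F := C(I, X)) t).tendsto w
    exact hlsc.measurable.comp measurable_snd
  · simp only [ofPred_forall]
    exact (isClosed_iInter fun t => hS.preimage (hev t)).measurableSet
  · exact (hB.preimage (hev 0)).measurableSet
  · refine measurableSet_lt ((ha.comp (hev 0).measurable).add
      (Measurable.mul (by fun_prop) ?_)) measurable_const
    refine Measurable.lintegral_prod_right'
      (f := fun z : (ℝ × C(I, X)) × ℝ => ρ (z.1.2 (projIcc 0 1 zero_le_one z.2))) ?_
    refine hρ.comp (Continuous.measurable ?_)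
    exact (by fun_prop : Continuous fun z : (ℝ × C(I, X)) × ℝ => z.1.2).eval
      (continuous_projIcc.comp continuous_snd)

theorem aemeasurable_reachCost [CompleteSpace X] [SecondCountableTopology X] {a ρ : X → ℝ≥0∞}
    (ha : Measurable a) (hρ : Measurable ρ) {S B : Set X} (hS : IsClosed S) (hB : IsClosed B)
    (ν : Measure X) [IsFiniteMeasure ν] : AEMeasurable (reachCost a ρ S B) ν := by
  have h : NullMeasurable (reachCost a ρ S B) ν := by
    refine measurable_of_Iio (δ := NullMeasurableSpace X ν) fun c => ?_
    exact nullMeasurableSet_of_analyticSet ν (analyticSet_reachCost_lt ha hρ hS hB c)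
  exact h.aemeasurable

end

/-! ### Separability, and admissible densities from Dirichlet competitors -/

section

variable {X : Type*} [MetricSpace X]

/-- A metric space with a measure for which all balls have positive finite measure is separable. -/
theorem secondCountableTopology_of_measure_ball [MeasurableSpace X] [OpensMeasurableSpace X]
    {μ : Measure X} (h : ∀ (x : X) (r : ℝ), 0 < r →
      0 < μ (Metric.ball x r) ∧ μ (Metric.ball x r) < ∞) : SecondCountableTopology X := by
  refine Metric.secondCountable_of_almost_dense_set fun ε hε => ?_
  -- A maximal `ε`-separated set is `ε`-dense. It is countable because the balls of radius `ε / 2`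
  -- around its points in a bounded region are disjoint, have positive measure and lie in a ball of
  -- finite measure.
  obtain ⟨s, hs⟩ := zorn_subset {s : Set X | s.Pairwise fun x y => ε ≤ dist x y} (by
    intro c hc hchain
    refine ⟨⋃₀ c, ?_, fun t ht => subset_sUnion_of_mem ht⟩
    exact (pairwise_sUnion hchain.directedOn).2 fun t ht => hc ht)
  refine ⟨s, ?_, ?_⟩
  · rcases isEmpty_or_nonempty X with hX | ⟨⟨x₀⟩⟩
    · exact (subsingleton_of_subsingleton (s := s)).countable
    have hU : s = ⋃ n : ℕ, s ∩ Metric.ball x₀ n := by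
      rw [← inter_iUnion, Metric.iUnion_ball_nat, inter_univ]
    rw [hU]
    refine countable_iUnion fun n => ?_
    have hsub : (⋃ y : ↥(s ∩ Metric.ball x₀ n), Metric.ball (y : X) (ε / 2)) ⊆
        Metric.ball x₀ (n + ε) := by
      refine iUnion_subset fun y => Metric.ball_subset_ball' ?_
      have := Metric.mem_ball.1 y.2.2
      linarith
    have hfin : μ (Metric.ball x₀ (n + ε)) < ∞ := (h x₀ _ (by positivity)).2
    have hc := Measure.countable_meas_pos_of_disjoint_of_meas_iUnion_ne_top μ
      (As := fun y : ↥(s ∩ Metric.ball x₀ n) => Metric.ball (y : X) (ε / 2))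
      (fun y => Metric.isOpen_ball.measurableSet) (by
        intro y z hyz
        refine Metric.ball_disjoint_ball ?_
        have := hs.prop y.2.1 z.2.1 (Subtype.coe_injective.ne hyz)
        linarith) (ne_top_of_le_ne_top hfin.ne (measure_mono hsub))
    have huniv : {y : ↥(s ∩ Metric.ball x₀ n) | 0 < μ (Metric.ball (y : X) (ε / 2))} = univ :=
      eq_univ_of_forall fun y => (h _ _ (by positivity)).1
    rw [huniv] at hc
    exact countable_coe_iff.1 (countable_univ_iff.1 hc)
  · intro x
    by_contra! hx
    have hins : (insert x s).Pairwise fun x y => ε ≤ dist x y :=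
      hs.prop.insert fun y hy _ => ⟨(hx y hy).le, by rw [dist_comm]; exact (hx y hy).le⟩
    have hxs : x ∈ s := hs.le_of_ge hins (subset_insert x s) (mem_insert x s)
    have := hx x hxs
    rw [dist_self] at this
    linarith

theorem EReal.of_sub_eq {u f F : EReal} (hF : F ≠ ⊤ ∧ F ≠ ⊥) (hf : f ≠ ⊤ ∧ f ≠ ⊥)
    (h : F = u - f) : (u ≠ ⊤ ∧ u ≠ ⊥) ∧ u.toReal = F.toReal + f.toReal := by
  subst h
  lift f to ℝ using hf
  induction u <;> simp_all [← EReal.coe_sub]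

variable [MeasurableSpace X] [BorelSpace X] {p : ℝ} {μ : Measure X} {Ω : Set X}

-- Nullity of the boundary enters only through this identity: values of a density on the boundary do
-- not affect its energy, although they may affect curve integrals.
omit [BorelSpace X] in
theorem restrict_closure_eq (hbdry : μ (frontier Ω) = 0) :
    μ.restrict (closure Ω) = μ.restrict Ω := by
  refine Measure.restrict_congr_set ?_
  rw [closure_eq_self_union_frontier]
  exact union_ae_eq_left_of_ae_eq_empty (ae_eq_empty.2 hbdry)

/-- A weak upper gradient in `Ω` of a competitor extends to a weakly admissible density. -/
theorem exists_isWeaklyAdmissible (hp : 1 ≤ p) (hΩ : IsOpen Ω) (hbdry : μ (frontier Ω) = 0)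
    {f u : X → EReal} (hf : MemNewtonian p μ (closure Ω) f) (hu : IsCompetitor p μ Ω f u)
    {g : X → ℝ≥0∞} (hgw : IsWeakUpperGradient p μ Ω u g) (hg : ∫⁻ x in Ω, g x ^ p ∂μ < ∞) :
    ∃ ρ : X → ℝ≥0∞, IsWeaklyAdmissible p μ (closure Ω) (boundaryCurves Ω) (endpointVariation f) ρ ∧
      ∀ x ∈ Ω, ρ x = g x := by
  classical
  have hp0 : 0 < p := by linarith
  obtain ⟨-, -, Gf, hGf, hGfi⟩ := hf
  obtain ⟨F, ⟨-, -, GF, hGF, hGFi⟩, hF0, hFu⟩ := hu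
  obtain ⟨η₀, hη₀m, hη₀i, -, hη₀⟩ := hgw.exists_density hp hg
  let G : X → ℝ≥0∞ := fun x => GF x + Gf x
  have hGm : Measurable G := hGF.1.add hGf.1
  have hGi : ∫⁻ x in closure Ω, G x ^ p ∂μ < ∞ := lintegral_add_rpow_lt_top hp hGF.1 hGFi hGfi
  let θ : X → ℝ≥0∞ := Ω.indicator fun x => g x + η₀ x
  have hθm : Measurable θ := (hgw.1.add hη₀m).indicator hΩ.measurableSet
  have hθi : ∫⁻ x in closure Ω, θ x ^ p ∂μ < ∞ := by
    rw [restrict_closure_eq hbdry]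
    refine lt_of_eq_of_lt (setLIntegral_congr_fun hΩ.measurableSet fun x hx => ?_)
      (lintegral_add_rpow_lt_top hp hgw.1 hg hη₀i)
    simp [θ, hx]
  refine ⟨Ω.piecewise g G, ⟨hgw.1.piecewise hΩ.measurableSet hGm, ?_⟩,
    fun x hx => piecewise_eq_of_mem _ _ _ hx⟩
  refine (aeCurve_iff hp0).2 ⟨fun x => G x + θ x, hGm.add hθm,
    lintegral_add_rpow_lt_top hp hGm hGi hθi, fun γ hγ hfin => ?_⟩
  rw [lineIntegral_add hGm, ENNReal.add_ne_top] at hfin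
  obtain ⟨hGfin, hθfin⟩ := hfin
  have hGfin' := hGfin
  rw [lineIntegral_add hGF.1, ENNReal.add_ne_top] at hGfin'
  rw [endpointVariation]
  split_ifs with h0
  · exact zero_le
  have hpos : 0 < γ.length := lt_of_le_of_ne γ.length_nonneg (Ne.symm h0)
  have bF := hGF.hasVariationBound hγ.1
  have bf := hGf.hasVariationBound hγ.1
  have finF := fun {t} (ht : t ∈ Icc 0 γ.length) => bF.ne_top_bot hpos hGfin'.1 ht
  have finf := fun {t} (ht : t ∈ Icc 0 γ.length) => bf.ne_top_bot hpos hGfin'.2 ht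
  -- This continues `u` along the curve across the boundary: it is `u` at times in `Ω`, and at the
  -- two end points it is `f`, since `F` vanishes there.
  let h : ℝ → ℝ := fun t => (F (γ.toFun t)).toReal + (f (γ.toFun t)).toReal
  let U : Set ℝ := γ.toFun ⁻¹' Ω
  obtain ⟨V, hV, hUV⟩ := continuousOn_iff'.1 γ.continuousOn Ω hΩ
  have hUV' : U ∩ Ioo 0 γ.length = V ∩ Ioo 0 γ.length := by
    rw [← inter_eq_self_of_subset_right (Ioo_subset_Icc_self (a := 0) (b := γ.length)),
      ← inter_assoc, ← inter_assoc, hUV]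
  -- The gluing lemma needs a finite integral over the whole curve, but `g` is controlled only in
  -- `Ω`, hence the indicator.
  have key := ofReal_abs_sub_le_lintegral_piecewise (h := h) (G := fun t => G (γ.toFun t))
    (g := fun t => Ω.indicator g (γ.toFun t)) (U := U) hpos.le hV hUV'
    (γ.aemeasurable_comp hGm) hGfin ?_
    (γ.aemeasurable_comp (hgw.1.indicator hΩ.measurableSet)) ?_ ?_
  · have hb : (f γ.source - f γ.target).abs = ENNReal.ofReal |h 0 - h γ.length| := by
      have e0 : F (γ.toFun 0) = 0 := hF0 _ hγ.2.1
      have e1 : F (γ.toFun γ.length) = 0 := hF0 _ hγ.2.2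
      rw [RectCurve.source, RectCurve.target, EReal.abs_sub_eq_ofReal
        (finf ⟨le_rfl, hpos.le⟩) (finf ⟨hpos.le, le_rfl⟩)]
      simp [h, e0, e1]
    rw [hb]
    refine key.trans (le_of_eq (lintegral_congr fun t => ?_))
    by_cases ht : γ.toFun t ∈ Ω
    · rw [piecewise_eq_of_mem _ _ _ ht, piecewise_eq_of_mem _ _ _ (show t ∈ U from ht),
        indicator_of_mem ht]
    · rw [piecewise_eq_of_notMem _ _ _ ht, piecewise_eq_of_notMem _ _ _ (show t ∉ U from ht)]
  · intro s t hs hst ht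
    have h1 := bF.ofReal_le hpos hGfin'.1 s t hs hst ht
    have h2 := bf.ofReal_le hpos hGfin'.2 s t hs hst ht
    calc ENNReal.ofReal |h s - h t|
        ≤ ENNReal.ofReal (|(F (γ.toFun s)).toReal - (F (γ.toFun t)).toReal| +
            |(f (γ.toFun s)).toReal - (f (γ.toFun t)).toReal|) := by
          refine ENNReal.ofReal_le_ofReal (le_trans (le_of_eq ?_) (abs_add_le _ _))
          congr 1
          simp only [h]
          ring
      _ ≤ _ := ENNReal.ofReal_add_le
      _ ≤ (∫⁻ r in Icc s t, GF (γ.toFun r)) + ∫⁻ r in Icc s t, Gf (γ.toFun r) :=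
          add_le_add h1 h2
      _ = _ := (lintegral_add_left' ((γ.aemeasurable_comp hGF.1).mono_set
          (Icc_subset_Icc hs ht)) _).symm
  · refine ne_top_of_le_ne_top hθfin (lintegral_mono fun t => ?_)
    exact indicator_le_indicator le_self_add
  · intro s t hs hst ht hsub
    rcases hst.eq_or_lt with rfl | hlt
    · simp
    have hst' : Icc s t ⊆ Icc 0 γ.length := Icc_subset_Icc hs ht
    have hreal : ∀ r ∈ Icc s t, (u (γ.toFun r) ≠ ⊤ ∧ u (γ.toFun r) ≠ ⊥) ∧
        (u (γ.toFun r)).toReal = h r := fun r hr =>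
      EReal.of_sub_eq (finF (hst' hr)) (finf (hst' hr)) (hFu _ (hsub hr))
    have hη := hη₀ γ s t hs hlt ht hsub ?_
    · rw [EReal.abs_sub_eq_ofReal (hreal s (left_mem_Icc.2 hst)).1
        (hreal t (right_mem_Icc.2 hst)).1, (hreal s (left_mem_Icc.2 hst)).2,
        (hreal t (right_mem_Icc.2 hst)).2] at hη
      refine hη.trans (le_of_eq (setLIntegral_congr_fun measurableSet_Icc fun r hr => ?_))
      exact (indicator_of_mem (show γ.toFun r ∈ Ω from hsub hr) g).symm
    · refine ne_top_of_le_ne_top hθfin (le_trans ?_ (lintegral_mono_set hst'))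
      refine setLIntegral_mono' measurableSet_Icc fun r hr => ?_
      have : γ.toFun r ∈ Ω := hsub hr
      simp [θ, this]

end

/-! ### Truncated boundary data and the boundary values of the least cost -/

section

/-- The truncation `max (-k) (min y k) + k` of the finite values `y`. -/
noncomputable def shiftedTrunc (k : ℕ) (y : EReal) : ℝ≥0∞ :=
  ENNReal.ofReal (min (y.toReal + k) (2 * k))

theorem measurable_shiftedTrunc (k : ℕ) : Measurable (shiftedTrunc k) :=
  ((measurable_ereal_toReal.add_const _).min measurable_const).ennreal_ofReal

theorem shiftedTrunc_le (k : ℕ) (y : EReal) : shiftedTrunc k y ≤ ENNReal.ofReal (2 * k) :=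
  ENNReal.ofReal_le_ofReal (min_le_right _ _)

theorem toReal_shiftedTrunc (k : ℕ) (y : EReal) :
    (shiftedTrunc k y).toReal = max (min (y.toReal + k) (2 * k)) 0 :=
  ENNReal.toReal_ofReal'

theorem shiftedTrunc_le_add (k : ℕ) (y z : EReal) :
    shiftedTrunc k y ≤ shiftedTrunc k z + (z - y).abs := by
  by_cases h : (z - y).abs = ∞
  · rw [h, add_top]
    exact le_top
  obtain ⟨hz, hy⟩ := EReal.ne_top_bot_of_abs_sub_ne_top h
  rw [EReal.abs_sub_eq_ofReal hz hy]
  refine le_trans (ENNReal.ofReal_le_ofReal ?_) ENNReal.ofReal_add_le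
  have := neg_abs_le (z.toReal - y.toReal)
  have h0 := abs_nonneg (z.toReal - y.toReal)
  rw [← min_add_add_right]
  exact min_le_min (by linarith) (by linarith)

theorem abs_toReal_shiftedTrunc_sub_le (k : ℕ) (y z : EReal) :
    |(shiftedTrunc k y).toReal - (shiftedTrunc k z).toReal| ≤ |y.toReal - z.toReal| := by
  rw [toReal_shiftedTrunc, toReal_shiftedTrunc]
  refine (abs_max_sub_max_le_abs _ _ _).trans ?_
  rw [min_comm, min_comm (z.toReal + k)]
  refine (abs_min_sub_min_le_max _ _ _ _).trans ?_
  simp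

/-- The truncation and the remainder are both nondecreasing functions of the real value and their
increments add up to its increment, so neither exceeds it. -/
theorem abs_sub_toReal_shiftedTrunc_sub_le (k : ℕ) (y z : EReal) :
    |(y.toReal - (shiftedTrunc k y).toReal) - (z.toReal - (shiftedTrunc k z).toReal)| ≤
      |y.toReal - z.toReal| := by
  rw [toReal_shiftedTrunc, toReal_shiftedTrunc]
  generalize y.toReal = a
  generalize z.toReal = b
  have hk : (0 : ℝ) ≤ k := k.cast_nonneg
  rcases max_cases (min (a + k) (2 * (k : ℝ))) 0 with ⟨h1, h1'⟩ | ⟨h1, h1'⟩ <;>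
  rcases max_cases (min (b + k) (2 * (k : ℝ))) 0 with ⟨h2, h2'⟩ | ⟨h2, h2'⟩ <;>
  rcases min_cases (a + k) (2 * (k : ℝ)) with ⟨h3, h3'⟩ | ⟨h3, h3'⟩ <;>
  rcases min_cases (b + k) (2 * (k : ℝ)) with ⟨h4, h4'⟩ | ⟨h4, h4'⟩ <;>
  rw [h1, h2] <;> (try rw [h3]) <;> (try rw [h4]) <;> rw [abs_le] <;>
  constructor <;> cases abs_cases (a - b) <;> linarith

theorem sub_toReal_shiftedTrunc_eq (k : ℕ) {y : EReal} (hy : |y.toReal| < k) :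
    y.toReal - (shiftedTrunc k y).toReal = -k := by
  have := abs_lt.1 hy
  rw [toReal_shiftedTrunc, min_eq_left (by linarith), max_eq_left (by linarith)]
  ring

variable {X : Type*} [MetricSpace X]

/-- The least cost of reaching a point from `B` changes along a curve by at most the integral of the
density. -/
theorem reachCost_target_le (a ρ : X → ℝ≥0∞) {S B : Set X} {γ : RectCurve X}
    (hγ : γ ∈ curvesIn S) :
    reachCost a ρ S B γ.target ≤ reachCost a ρ S B γ.source + lineIntegral ρ γ := by
  simp only [reachCost, ENNReal.iInf_add]
  refine le_iInf₂ fun δ hδ => ?_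
  refine iInf₂_le_of_le (δ.concat γ hδ.2.2)
    ⟨concat_mem_curvesIn _ hδ.1 hγ, ?_, RectCurve.target_concat _ _ _⟩ ?_
  · rw [RectCurve.source_concat]
    exact hδ.2.1
  · rw [RectCurve.source_concat, lineIntegral_concat, add_assoc]

theorem ofReal_abs_toReal_sub_le {x y c : ℝ≥0∞} (hx : x ≠ ∞) (hy : y ≠ ∞)
    (h1 : x ≤ y + c) (h2 : y ≤ x + c) : ENNReal.ofReal |x.toReal - y.toReal| ≤ c := by
  rcases eq_or_ne c ∞ with rfl | hc
  · exact le_top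
  rw [ENNReal.ofReal_le_iff_le_toReal hc, abs_le]
  have h1' := ENNReal.toReal_mono (ENNReal.add_ne_top.2 ⟨hy, hc⟩) h1
  have h2' := ENNReal.toReal_mono (ENNReal.add_ne_top.2 ⟨hx, hc⟩) h2
  rw [ENNReal.toReal_add hy hc] at h1'
  rw [ENNReal.toReal_add hx hc] at h2'
  constructor <;> linarith

/-- The truncated least cost changes along a curve by at most the integral of the density. -/
theorem ofReal_abs_min_reachCost_sub_le (a ρ : X → ℝ≥0∞) {S B : Set X} {M : ℝ≥0∞} (hM : M ≠ ∞)
    {γ : RectCurve X} (hγ : γ ∈ curvesIn S) :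
    ENNReal.ofReal |(min (reachCost a ρ S B γ.source) M).toReal -
      (min (reachCost a ρ S B γ.target) M).toReal| ≤ lineIntegral ρ γ := by
  have hfin : ∀ x, min (reachCost a ρ S B x) M ≠ ∞ := fun x =>
    ne_top_of_le_ne_top hM (min_le_right _ _)
  have h1 := reachCost_target_le a ρ (B := B) hγ
  have h2 := reachCost_target_le a ρ (B := B) (reverse_mem_curvesIn hγ)
  rw [RectCurve.target_reverse, RectCurve.source_reverse, lineIntegral_reverse] at h2
  refine ofReal_abs_toReal_sub_le (hfin _) (hfin _) ?_ ?_
  · rw [← min_add_add_right]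
    exact min_le_min h2 le_self_add
  · rw [← min_add_add_right]
    exact min_le_min h1 le_self_add

variable [MeasurableSpace X]

/-- For admissible densities, the least cost of reaching a boundary point is the boundary value. -/
theorem min_reachCost_eq {Ω : Set X} {f : X → EReal} {ρ : X → ℝ≥0∞}
    (hρ : IsAdmissible (boundaryCurves Ω) (endpointVariation f) ρ) (k : ℕ) {x : X}
    (hx : x ∈ frontier Ω) :
    min (reachCost (fun y => shiftedTrunc k (f y)) ρ (closure Ω) (frontier Ω) x)
      (ENNReal.ofReal (2 * k)) = shiftedTrunc k (f x) := by
  refine le_antisymm ((min_le_left _ _).trans ?_) (le_min ?_ (shiftedTrunc_le _ _))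
  -- Staying at `x` costs exactly the boundary value. This is where constant curves are needed.
  · refine iInf₂_le_of_le (RectCurve.const x)
      ⟨fun t _ => frontier_subset_closure hx, hx, rfl⟩ ?_
    rw [lineIntegral_const, add_zero]
    exact le_rfl
  -- No other starting point is cheaper: by admissibility the integral of `ρ` pays for the variation
  -- of `f`, and truncation does not increase variation.
  · refine le_iInf₂ fun γ hγ => ?_
    obtain ⟨h1, h2, rfl⟩ := hγ
    have := hρ.2 γ ⟨h1, h2, hx⟩
    rw [endpointVariation] at this
    split_ifs at this with h0
    · rw [γ.target_eq_source_of_length_eq_zero h0]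
      exact le_self_add
    · refine (shiftedTrunc_le_add k (f γ.target) (f γ.source)).trans ?_
      gcongr

variable [BorelSpace X] {p : ℝ} {μ : Measure X} {Ω : Set X}

omit [MetricSpace X] [BorelSpace X] in
theorem ae_ne_top_bot {ν : Measure X} (hp : 0 < p) {f : X → EReal} (hf : Measurable f)
    (h : ∫⁻ x, (f x).abs ^ p ∂ν < ∞) : ∀ᵐ x ∂ν, f x ≠ ⊤ ∧ f x ≠ ⊥ := by
  have hm : Measurable EReal.abs := by
    refine EReal.measurable_of_measurable_real ?_
    simp only [EReal.abs_def]
    fun_prop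
  filter_upwards [ae_lt_top ((hm.comp hf).pow_const p) h.ne] with x hx
  constructor <;> intro htop <;> simp [htop, hp] at hx

/-- The energy infimum is bounded by the energy of every weak upper gradient of a competitor. -/
theorem dirichletInf_le (hp : 1 ≤ p) {f v : X → EReal} (hv : IsCompetitor p μ Ω f v)
    {g : X → ℝ≥0∞} (hg : IsWeakUpperGradient p μ Ω v g) (hgi : ∫⁻ x in Ω, g x ^ p ∂μ < ∞) :
    dirichletInf p μ Ω f ≤ ∫⁻ x in Ω, g x ^ p ∂μ := by
  -- The infimum ranges over minimal gradients only, so one has to be produced below `g`.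
  obtain ⟨g₀, hg₀⟩ := exists_isMinimalWeakUpperGradient hp hg hgi
  refine (iInf₂_le_of_le v hv (iInf₂_le g₀ hg₀)).trans (lintegral_mono_ae ?_)
  filter_upwards [hg₀.2.2 g hg hgi] with x hx
  exact ENNReal.rpow_le_rpow hx (by linarith)

end

/-! ### Dirichlet competitors from admissible densities -/

section

variable {X : Type*} [MetricSpace X]

theorem EReal.coe_add_sub_self {r : ℝ} {y : EReal} (hy : y ≠ ⊤ ∧ y ≠ ⊥) :
    ((r : EReal) + y ≠ ⊤ ∧ (r : EReal) + y ≠ ⊥) ∧ ((r : EReal) + y).toReal = r + y.toReal ∧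
      (r : EReal) + y - y = r := by
  lift y to ℝ using hy
  rw [← EReal.coe_add, ← EReal.coe_sub, add_sub_cancel_right, EReal.toReal_coe, EReal.toReal_coe]
  exact ⟨⟨EReal.coe_ne_top _, EReal.coe_ne_bot _⟩, rfl, rfl⟩

/-- The difference of the truncated least cost from the boundary and of the truncated boundary
data. -/
noncomputable def costCorrection (Ω : Set X) (f : X → EReal) (ρ : X → ℝ≥0∞) (k : ℕ) (x : X) : ℝ :=
  (min (reachCost (fun y => shiftedTrunc k (f y)) ρ (closure Ω) (frontier Ω) x)
    (ENNReal.ofReal (2 * k))).toReal - (shiftedTrunc k (f x)).toReal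

theorem abs_costCorrection_le (Ω : Set X) (f : X → EReal) (ρ : X → ℝ≥0∞) (k : ℕ) (x : X) :
    |costCorrection Ω f ρ k x| ≤ 2 * k := by
  have h : ∀ z : ℝ≥0∞, z ≤ ENNReal.ofReal (2 * k) → z.toReal ≤ 2 * k := fun z hz =>
    ENNReal.toReal_le_of_le_ofReal (by positivity) hz
  rw [costCorrection, abs_le]
  have h1 := h _ (min_le_right
    (reachCost (fun y => shiftedTrunc k (f y)) ρ (closure Ω) (frontier Ω) x) _)
  have h2 := h _ (shiftedTrunc_le k (f x))
  constructor <;> linarith [ENNReal.toReal_nonneg (a := shiftedTrunc k (f x)),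
    ENNReal.toReal_nonneg (a := min (reachCost (fun y => shiftedTrunc k (f y)) ρ (closure Ω)
      (frontier Ω) x) (ENNReal.ofReal (2 * k)))]

variable [MeasurableSpace X] [BorelSpace X] {p : ℝ} {μ : Measure X} {Ω : Set X}

theorem aemeasurable_costCorrection [CompleteSpace X] [SecondCountableTopology X]
    {f : X → EReal} (hf : Measurable f) {ρ : X → ℝ≥0∞} (hρ : Measurable ρ) (k : ℕ)
    (ν : Measure X) [IsFiniteMeasure ν] : AEMeasurable (costCorrection Ω f ρ k) ν := by
  have ha : Measurable fun y => shiftedTrunc k (f y) := (measurable_shiftedTrunc k).comp hf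
  exact ((aemeasurable_reachCost ha hρ isClosed_closure isClosed_frontier ν).min
    aemeasurable_const).ennreal_toReal.sub ha.ennreal_toReal.aemeasurable

/-- The correction vanishes on the boundary because the truncated cost attains the truncated data
there. In `EReal`, adding and subtracting `f` gives back the correction only where `f` is finite;
this holds almost everywhere, and at all points of a nonconstant curve along which the upper
gradient `G` of `f` has finite integral, which suffices for `ρ + G` to be a weak upper gradient. -/
theorem isCompetitor_costCorrection [CompleteSpace X] [SecondCountableTopology X] (hp : 1 ≤ p)
    (hΩ : IsOpen Ω) (hfin : μ (closure Ω) < ∞) {f : X → EReal} (hfm : Measurable f)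
    (hf : MemNewtonian p μ (closure Ω) f) {ρ : X → ℝ≥0∞}
    (hρ : IsAdmissible (boundaryCurves Ω) (endpointVariation f) ρ)
    (hρi : ∫⁻ x in closure Ω, ρ x ^ p ∂μ < ∞) (k : ℕ) :
    IsCompetitor p μ Ω f (fun x => (costCorrection Ω f ρ k x : EReal) + f x) := by
  classical
  have hp0 : 0 < p := by linarith
  obtain ⟨-, hfi, G, hG, hGi⟩ := hf
  let F : X → EReal := fun x =>
    if x ∈ Ω then (costCorrection Ω f ρ k x : EReal) + f x - f x else 0
  have hF : ∀ x ∈ closure Ω, f x ≠ ⊤ ∧ f x ≠ ⊥ → F x = (costCorrection Ω f ρ k x : EReal) := by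
    intro x hx hfx
    by_cases hxΩ : x ∈ Ω
    · simp only [F, hxΩ, if_true]
      exact (EReal.coe_add_sub_self hfx).2.2
    · have hxb : x ∈ frontier Ω := by
        rw [hΩ.frontier_eq]
        exact ⟨hx, hxΩ⟩
      simp only [F, hxΩ, if_false]
      rw [costCorrection, min_reachCost_eq hρ k hxb, sub_self, EReal.coe_zero]
  have : IsFiniteMeasure (μ.restrict (closure Ω)) := isFiniteMeasure_restrict.2 hfin.ne
  have hae : F =ᵐ[μ.restrict (closure Ω)] fun x => (costCorrection Ω f ρ k x : EReal) := by
    filter_upwards [ae_ne_top_bot hp0 hfm hfi, ae_restrict_mem isClosed_closure.measurableSet]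
      with x hx hxc
    exact hF x hxc hx
  have hgi : ∫⁻ x in closure Ω, (ρ x + G x) ^ p ∂μ < ∞ :=
    lintegral_add_rpow_lt_top hp hρ.1 hρi hGi
  refine ⟨F, ⟨?_, ?_, ?_⟩, ?_, ?_⟩
  · exact (measurable_coe_real_ereal.comp_aemeasurable
      (aemeasurable_costCorrection hfm hρ.1 k _)).congr hae.symm
  · calc ∫⁻ x in closure Ω, (F x).abs ^ p ∂μ
        ≤ ∫⁻ _ in closure Ω, ENNReal.ofReal (2 * k) ^ p ∂μ := by
          refine lintegral_mono_ae ?_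
          filter_upwards [hae] with x hx
          rw [hx, EReal.abs_def]
          exact ENNReal.rpow_le_rpow (ENNReal.ofReal_le_ofReal (abs_costCorrection_le ..)) hp0.le
      _ < ∞ := by
          rw [setLIntegral_const]
          exact ENNReal.mul_lt_top
            (ENNReal.rpow_lt_top_of_nonneg hp0.le ENNReal.ofReal_ne_top) hfin
  · refine (isWeakUpperGradient_of_density hp0 (hρ.1.add hG.1) (hρ.1.add hG.1) hgi
      fun γ hγ hpos hlfin => ?_).exists_isUpperGradient hp hgi
    have hlfin' : lineIntegral (fun x => ρ x + G x) γ ≠ ∞ := hlfin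
    rw [lineIntegral_add hρ.1, ENNReal.add_ne_top] at hlfin'
    have bf := hG.hasVariationBound hγ
    have h0 : (0 : ℝ) ∈ Icc 0 γ.length := ⟨le_rfl, hpos.le⟩
    have h1 : γ.length ∈ Icc 0 γ.length := ⟨hpos.le, le_rfl⟩
    rw [RectCurve.source, RectCurve.target, hF _ (hγ _ h0) (bf.ne_top_bot hpos hlfin'.2 h0),
      hF _ (hγ _ h1) (bf.ne_top_bot hpos hlfin'.2 h1), ← EReal.coe_sub, EReal.abs_def]
    change _ ≤ lineIntegral (fun x => ρ x + G x) γ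
    rw [lineIntegral_add hρ.1]
    have e1 := ofReal_abs_min_reachCost_sub_le (fun y => shiftedTrunc k (f y)) ρ
      (B := frontier Ω) (M := ENNReal.ofReal (2 * k)) ENNReal.ofReal_ne_top hγ
    have e2 : ENNReal.ofReal |(shiftedTrunc k (f γ.source)).toReal -
        (shiftedTrunc k (f γ.target)).toReal| ≤ lineIntegral G γ :=
      (ENNReal.ofReal_le_ofReal (abs_toReal_shiftedTrunc_sub_le k _ _)).trans
        (bf.ofReal_le hpos hlfin'.2 0 γ.length le_rfl hpos.le le_rfl)
    refine le_trans ?_ (add_le_add e1 e2)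
    refine le_trans (ENNReal.ofReal_le_ofReal ?_) ENNReal.ofReal_add_le
    refine le_trans (le_of_eq ?_) (abs_sub _ _)
    congr 1
    simp only [costCorrection, RectCurve.source, RectCurve.target]
    ring
  · intro x hx
    rw [hΩ.frontier_eq] at hx
    simp [F, hx.2]
  · intro x hx
    simp [F, hx]

/-- The function is the truncated cost plus the remainder of `f` after truncation. The first part is
controlled by `ρ`. The remainder is constantly `-k` where `|f| < k`, so gluing with the zero density
there leaves `G` only on `|f| ≥ k`. -/
theorem isWeakUpperGradient_costCorrection (hp : 1 ≤ p) {f : X → EReal} (hfm : Measurable f)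
    {G : X → ℝ≥0∞} (hG : IsUpperGradient (closure Ω) f G)
    (hGi : ∫⁻ x in Ω, G x ^ p ∂μ < ∞) {ρ : X → ℝ≥0∞} (hρ : Measurable ρ)
    (hρi : ∫⁻ x in Ω, ρ x ^ p ∂μ < ∞) (k : ℕ) :
    IsWeakUpperGradient p μ Ω (fun x => (costCorrection Ω f ρ k x : EReal) + f x)
      (fun x => ρ x + {y | (k : ℝ) ≤ |(f y).toReal|}.indicator G x) := by
  classical
  have hp0 : 0 < p := by linarith
  have hAm : MeasurableSet {y | (k : ℝ) ≤ |(f y).toReal|} :=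
    measurableSet_le measurable_const (_root_.continuous_abs.measurable.comp hfm.ereal_toReal)
  refine isWeakUpperGradient_of_density hp0 (hρ.add (hG.1.indicator hAm)) (hρ.add hG.1)
    (lintegral_add_rpow_lt_top hp hρ hρi hGi) fun γ hγΩ hpos hfin => ?_
  have hγ : γ ∈ curvesIn (closure Ω) := fun t ht => subset_closure (hγΩ t ht)
  have hfin' : lineIntegral (fun x => ρ x + G x) γ ≠ ∞ := hfin
  rw [lineIntegral_add hρ, ENNReal.add_ne_top] at hfin'
  rw [lineIntegral_add hρ]
  have bf := hG.hasVariationBound hγ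
  have hreal := fun t (ht : t ∈ Icc 0 γ.length) =>
    EReal.coe_add_sub_self (r := costCorrection Ω f ρ k (γ.toFun t))
      (bf.ne_top_bot hpos hfin'.2 ht)
  have h0 : (0 : ℝ) ∈ Icc 0 γ.length := ⟨le_rfl, hpos.le⟩
  have h1 : γ.length ∈ Icc 0 γ.length := ⟨hpos.le, le_rfl⟩
  rw [RectCurve.source, RectCurve.target, EReal.abs_sub_eq_ofReal (hreal _ h0).1 (hreal _ h1).1,
    (hreal _ h0).2.1, (hreal _ h1).2.1]
  let φ : ℝ → ℝ := fun t => (f (γ.toFun t)).toReal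
  let h : ℝ → ℝ := fun t => φ t - (shiftedTrunc k (f (γ.toFun t))).toReal
  have hφ : ∀ s t, 0 ≤ s → s ≤ t → t ≤ γ.length →
      ENNReal.ofReal |φ s - φ t| ≤ ∫⁻ r in Icc s t, G (γ.toFun r) := bf.ofReal_le hpos hfin'.2
  let U : Set ℝ := {t | |φ t| < k}
  -- Although `f` need not be continuous, it is absolutely continuous along a curve on which `G` has
  -- finite integral. This makes the set of times with `|f| < k` relatively open.
  have hφc : ContinuousOn (fun t => |φ t|) (Icc 0 γ.length) := by
    have := (absolutelyContinuous_and_deriv_le hpos.le (γ.aemeasurable_comp hG.1) hfin'.2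
      hφ).1.continuousOn
    rw [uIcc_of_le hpos.le] at this
    exact this.abs
  obtain ⟨V, hV, hUV⟩ := continuousOn_iff'.1 hφc (Iio (k : ℝ)) isOpen_Iio
  have hUV' : U ∩ Ioo 0 γ.length = V ∩ Ioo 0 γ.length := by
    rw [← inter_eq_self_of_subset_right (Ioo_subset_Icc_self (a := 0) (b := γ.length)),
      ← inter_assoc, ← inter_assoc, ← hUV]
    rfl
  have key := ofReal_abs_sub_le_lintegral_piecewise (h := h) (G := fun t => G (γ.toFun t))
    (g := fun _ => 0) (U := U) hpos.le hV hUV'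
    (γ.aemeasurable_comp hG.1) hfin'.2 (fun s t hs hst ht =>
      (ENNReal.ofReal_le_ofReal (abs_sub_toReal_shiftedTrunc_sub_le k _ _)).trans
        (hφ s t hs hst ht))
    aemeasurable_const (by simp) (fun s t hs hst ht hsub => by
      have es := sub_toReal_shiftedTrunc_eq k (hsub (left_mem_Icc.2 hst))
      have et := sub_toReal_shiftedTrunc_eq k (hsub (right_mem_Icc.2 hst))
      simp only [h, φ, es, et, sub_self, abs_zero, ENNReal.ofReal_zero, lintegral_zero, le_refl])
  have key' : ENNReal.ofReal |h 0 - h γ.length| ≤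
      lineIntegral ({y | (k : ℝ) ≤ |(f y).toReal|}.indicator G) γ := by
    refine key.trans (le_of_eq (lintegral_congr fun t => ?_))
    by_cases ht : |φ t| < k
    · rw [piecewise_eq_of_mem _ _ _ (show t ∈ U from ht), indicator_of_notMem]
      exact fun hle => ht.not_ge hle
    · rw [piecewise_eq_of_notMem _ _ _ (show t ∉ U from ht), indicator_of_mem]
      exact not_lt.1 ht
  have e1 := ofReal_abs_min_reachCost_sub_le (fun y => shiftedTrunc k (f y)) ρ
    (B := frontier Ω) (M := ENNReal.ofReal (2 * k)) ENNReal.ofReal_ne_top hγ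
  refine le_trans ?_ (add_le_add e1 key')
  refine le_trans (ENNReal.ofReal_le_ofReal ?_) ENNReal.ofReal_add_le
  refine le_trans (le_of_eq ?_) (abs_add_le _ _)
  congr 1
  simp only [costCorrection, h, φ, RectCurve.source, RectCurve.target]
  ring

/-- The energy infimum in the Dirichlet problem is at most the modulus. -/
theorem dirichletInf_le_genModulus [CompleteSpace X] [SecondCountableTopology X] (hp : 1 ≤ p)
    (hΩ : IsOpen Ω) (hfin : μ (closure Ω) < ∞) {f : X → EReal} (hfm : Measurable f)
    (hf : MemNewtonian p μ (closure Ω) f) :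
    dirichletInf p μ Ω f ≤
      genModulus p μ (closure Ω) (boundaryCurves Ω) (endpointVariation f) := by
  have hp0 : 0 < p := by linarith
  refine le_iInf₂ fun ρ hρ => ?_
  rcases eq_or_ne (∫⁻ x in closure Ω, ρ x ^ p ∂μ) ∞ with htop | hρi
  · rw [htop]
    exact le_top
  obtain ⟨-, hfi, G, hG, hGi⟩ := id hf
  have hsub : ∀ g : X → ℝ≥0∞, ∫⁻ x in Ω, g x ∂μ ≤ ∫⁻ x in closure Ω, g x ∂μ := fun g =>
    lintegral_mono_set subset_closure
  have hρΩ : ∫⁻ x in Ω, ρ x ^ p ∂μ < ∞ := (hsub _).trans_lt hρi.lt_top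
  have hGΩ : ∫⁻ x in Ω, G x ^ p ∂μ < ∞ := (hsub _).trans_lt hGi
  have hfΩ : ∫⁻ x in Ω, (f x).abs ^ p ∂μ < ∞ := (hsub _).trans_lt hfi
  let g : ℕ → X → ℝ≥0∞ := fun k x => ρ x + {y | (k : ℝ) ≤ |(f y).toReal|}.indicator G x
  have hgle : ∀ k x, g k x ^ p ≤ (ρ x + G x) ^ p := fun k x =>
    ENNReal.rpow_le_rpow (add_le_add_right (indicator_le_self _ _ _) _) hp0.le
  have hsum : ∫⁻ x in Ω, (ρ x + G x) ^ p ∂μ < ∞ := lintegral_add_rpow_lt_top hp hρ.1 hρΩ hGΩ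
  have hgw := fun k => isWeakUpperGradient_costCorrection hp hfm hG hGΩ hρ.1 hρΩ k
  have hle : ∀ k, dirichletInf p μ Ω f ≤ ∫⁻ x in Ω, g k x ^ p ∂μ := fun k =>
    dirichletInf_le hp (isCompetitor_costCorrection hp hΩ hfin hfm hf hρ hρi.lt_top k) (hgw k)
      ((lintegral_mono (hgle k)).trans_lt hsum)
  have hlim : Tendsto (fun k => ∫⁻ x in Ω, g k x ^ p ∂μ) atTop (𝓝 (∫⁻ x in Ω, ρ x ^ p ∂μ)) := by
    refine tendsto_lintegral_of_dominated_convergence (fun x => (ρ x + G x) ^ p)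
      (fun k => (hgw k).1.pow_const p) (fun k => Eventually.of_forall (hgle k)) hsum.ne
      (Eventually.of_forall fun x => ?_)
    refine tendsto_const_nhds.congr' ?_
    -- Such an `n` exists at every point, since `toReal` sends infinite values to `0`; the
    -- convergence is therefore pointwise everywhere.
    obtain ⟨n, hn⟩ := exists_nat_gt |(f x).toReal|
    filter_upwards [eventually_ge_atTop n] with k hk
    have hlt : |(f x).toReal| < k := hn.trans_le (by exact_mod_cast hk)
    have : x ∉ {y | (k : ℝ) ≤ |(f y).toReal|} := fun hle => hlt.not_ge hle
    simp only [g, indicator_of_notMem this, add_zero]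
  exact (ge_of_tendsto' hlim hle).trans (hsub _)

end

/-! ### Strict convexity and uniqueness of weak minimizers -/

section

theorem rpow_midpoint_lt {p : ℝ} (hp : 1 < p) {a b : ℝ≥0∞} (ha : a ≠ ∞) (hb : b ≠ ∞)
    (hab : a ≠ b) : (2⁻¹ * a + 2⁻¹ * b) ^ p < 2⁻¹ * a ^ p + 2⁻¹ * b ^ p := by
  have hp0 : 0 ≤ p := by linarith
  lift a to ℝ≥0 using ha
  lift b to ℝ≥0 using hb
  have h2 : (2⁻¹ : ℝ≥0∞) = ((2⁻¹ : ℝ≥0) : ℝ≥0∞) := by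
    rw [ENNReal.coe_inv two_ne_zero, ENNReal.coe_ofNat]
  rw [h2]
  simp only [← ENNReal.coe_mul, ← ENNReal.coe_add, ← ENNReal.coe_rpow_of_nonneg _ hp0]
  rw [ENNReal.coe_lt_coe, ← NNReal.coe_lt_coe]
  push_cast
  have hab' : (a : ℝ) ≠ b := fun h => hab (by rw [NNReal.coe_injective h])
  have := (strictConvexOn_rpow hp).2 (mem_Ici.2 a.2) (mem_Ici.2 b.2) hab'
    (show (0 : ℝ) < 2⁻¹ by norm_num) (show (0 : ℝ) < 2⁻¹ by norm_num) (by norm_num)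
  simp only [smul_eq_mul] at this
  exact this

variable {X : Type*} [MetricSpace X] [MeasurableSpace X] [BorelSpace X] {p : ℝ} {μ : Measure X}
  {S : Set X} {Γ : Set (RectCurve X)} {b : RectCurve X → ℝ≥0∞}

/-- Weakly admissible densities are closed under taking midpoints. -/
theorem IsWeaklyAdmissible.midpoint (hp : 1 ≤ p) {ρ ρ' : X → ℝ≥0∞}
    (h : IsWeaklyAdmissible p μ S Γ b ρ) (h' : IsWeaklyAdmissible p μ S Γ b ρ') :
    IsWeaklyAdmissible p μ S Γ b (fun x => 2⁻¹ * ρ x + 2⁻¹ * ρ' x) := by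
  have hp0 : 0 < p := by linarith
  obtain ⟨η, hηm, hηi, hη⟩ := (aeCurve_iff hp0).1 h.2
  obtain ⟨η', hηm', hηi', hη'⟩ := (aeCurve_iff hp0).1 h'.2
  refine ⟨(h.1.const_mul _).add (h'.1.const_mul _), (aeCurve_iff hp0).2 ⟨fun x => η x + η' x,
    hηm.add hηm', lintegral_add_rpow_lt_top hp hηm hηi hηi', fun γ hγ hfin => ?_⟩⟩
  rw [lineIntegral_add hηm, ENNReal.add_ne_top] at hfin
  rw [lineIntegral_add (h.1.const_mul _), lineIntegral_const_mul _ h.1,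
    lineIntegral_const_mul _ h'.1]
  calc b γ = 2⁻¹ * b γ + 2⁻¹ * b γ := by
        rw [← add_mul, ENNReal.inv_two_add_inv_two, one_mul]
    _ ≤ _ := add_le_add (mul_le_mul_right (hη γ hγ hfin.1) _)
        (mul_le_mul_right (hη' γ hγ hfin.2) _)

/-- Weak minimizers of finite energy are unique. -/
theorem IsWeakMinimizer.ae_eq (hp : 1 < p) {ρ ρ' : X → ℝ≥0∞}
    (h : IsWeakMinimizer p μ S Γ b ρ) (h' : IsWeakMinimizer p μ S Γ b ρ')
    (hfin : genModulus p μ S Γ b < ∞) : ρ' =ᵐ[μ.restrict S] ρ := by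
  -- The midpoint has energy at least the modulus, while convexity bounds it by the average of two
  -- energies equal to the modulus. Equality then holds almost everywhere, and strict convexity
  -- forces the densities to agree.
  have hM := genModulus_le_of_isWeaklyAdmissible hp.le (h.1.midpoint hp.le h'.1)
  have hle : ∀ x, (2⁻¹ * ρ x + 2⁻¹ * ρ' x) ^ p ≤ 2⁻¹ * ρ x ^ p + 2⁻¹ * ρ' x ^ p := fun x =>
    ENNReal.rpow_arith_mean_le_arith_mean2_rpow _ _ _ _ ENNReal.inv_two_add_inv_two hp.le
  have hint : ∫⁻ x in S, (2⁻¹ * ρ x ^ p + 2⁻¹ * ρ' x ^ p) ∂μ = genModulus p μ S Γ b := by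
    rw [lintegral_add_left ((h.1.1.pow_const p).const_mul _),
      lintegral_const_mul _ (h.1.1.pow_const p), lintegral_const_mul _ (h'.1.1.pow_const p),
      h.2, h'.2, ← add_mul, ENNReal.inv_two_add_inv_two, one_mul]
  have hae := ae_eq_of_ae_le_of_lintegral_le (μ := μ.restrict S) (Eventually.of_forall hle)
    (ne_top_of_le_ne_top hfin.ne ((lintegral_mono hle).trans hint.le))
    (((h.1.1.pow_const p).const_mul _).add ((h'.1.1.pow_const p).const_mul _)).aemeasurable
    (hint.le.trans hM)
  have hf := ae_lt_top (h.1.1.pow_const p) (h.2.trans_lt hfin).ne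
  have hf' := ae_lt_top (h'.1.1.pow_const p) (h'.2.trans_lt hfin).ne
  filter_upwards [hae, hf, hf'] with x hx hx1 hx2
  by_contra hne
  refine (rpow_midpoint_lt hp ?_ ?_ (Ne.symm hne)).ne hx
  · exact fun htop => hx1.ne (by rw [htop, ENNReal.top_rpow_of_pos (by linarith)])
  · exact fun htop => hx2.ne (by rw [htop, ENNReal.top_rpow_of_pos (by linarith)])

omit [BorelSpace X] in
theorem measure_closure_lt_top {Ω : Set X} (hΩ : Bornology.IsBounded Ω) (h : ∀ (x : X) (r : ℝ),
    0 < r → 0 < μ (Metric.ball x r) ∧ μ (Metric.ball x r) < ∞) : μ (closure Ω) < ∞ := by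
  rcases Ω.eq_empty_or_nonempty with rfl | ⟨x, hx⟩
  · simp
  obtain ⟨r, hr, hsub⟩ := hΩ.closure.subset_ball_lt 0 x
  exact (measure_mono hsub).trans_lt (h x r hr).2

end

end MetricDirichlet

/-! ### Equality of the Dirichlet energy and the modulus -/

theorem proposition4p1 {X : Type*} [MetricSpace X] [CompleteSpace X] [MeasurableSpace X]
    [BorelSpace X] (μ : Measure X) (p : ℝ) (hp : 1 < p)
    (hdoubling : IsDoubling μ) (hpoincare : IsPoincare p μ)
    (Ω : Set X) (hΩ_open : IsOpen Ω) (hΩ_conn : IsConnected Ω)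
    (hΩ_bdd : Bornology.IsBounded Ω) (hΩ_bdry : μ (frontier Ω) = 0)
    (f : X → EReal) (hf_borel : Measurable f) (hf : MemNewtonian p μ (closure Ω) f)
    (u : X → EReal) (hu : IsDirichletSolution p μ Ω f u)
    (gu : X → ℝ≥0∞) (hgu : IsMinimalWeakUpperGradient p μ Ω u gu) :
    ∃ ρ : X → ℝ≥0∞,
      IsWeakMinimizer p μ (closure Ω) (boundaryCurves Ω) (endpointVariation f) ρ ∧
      ∫⁻ x in closure Ω, ρ x ^ p ∂μ < ∞ ∧
      (∀ ρ' : X → ℝ≥0∞,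
        IsWeakMinimizer p μ (closure Ω) (boundaryCurves Ω) (endpointVariation f) ρ' →
          ρ' =ᵐ[μ.restrict (closure Ω)] ρ) ∧
      gu =ᵐ[μ.restrict Ω] ρ ∧
      ∫⁻ x in Ω, gu x ^ p ∂μ =
        genModulus p μ (closure Ω) (boundaryCurves Ω) (endpointVariation f) := by
  have := secondCountableTopology_of_measure_ball hdoubling.1
  have hfin := measure_closure_lt_top hΩ_bdd hdoubling.1
  obtain ⟨ρ, hρ, hρg⟩ :=
    exists_isWeaklyAdmissible hp.le hΩ_open hΩ_bdry hf hu.1 hgu.1 hgu.2.1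
  have hE : ∫⁻ x in closure Ω, ρ x ^ p ∂μ = ∫⁻ x in Ω, gu x ^ p ∂μ := by
    rw [restrict_closure_eq hΩ_bdry]
    exact setLIntegral_congr_fun hΩ_open.measurableSet fun x hx => by rw [hρg x hx]
  have hM : ∫⁻ x in closure Ω, ρ x ^ p ∂μ =
      genModulus p μ (closure Ω) (boundaryCurves Ω) (endpointVariation f) := by
    -- The circle closes: the modulus is at most the energy of `ρ`, which is the energy of `gu`,
    -- hence the Dirichlet infimum, which is at most the modulus.
    refine le_antisymm ?_ (genModulus_le_of_isWeaklyAdmissible hp.le hρ)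
    rw [hE, hu.2 gu hgu]
    exact dirichletInf_le_genModulus hp.le hΩ_open hfin hf_borel hf
  have hlt : ∫⁻ x in closure Ω, ρ x ^ p ∂μ < ∞ := hE.trans_lt hgu.2.1
  refine ⟨ρ, ⟨hρ, hM⟩, hlt, fun ρ' hρ' => IsWeakMinimizer.ae_eq hp ⟨hρ, hM⟩ hρ' (hM ▸ hlt), ?_,
    hE.symm.trans hM⟩
  filter_upwards [ae_restrict_mem hΩ_open.measurableSet] with x hx
  exact (hρg x hx).symm
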